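/- We work in many-sorted first-order logic with equality. A signature $\Sigma$ has a nonempty set $\mathcal{S}_\Sigma$ of sorts, a set of function symbols with arities $(\sigma_1,\dots,\sigma_n,\sigma)$ and a set of predicate symbols with arities $(\sigma_1,\dots,\sigma_n)$, $n\ge 0$; each sort has countably infinitely many variables. A $\Sigma$-interpretation $\mathcal{A}$ is a $\Sigma$-structure with nonempty domains $\sigma^{\mathcal{A}}$ together with an assignment of the variables. A $\Sigma$-theory $\mathcal{T}$ is a set of $\Sigma$-sentences; a $\mathcal{T}$-interpretation is a $\Sigma$-interpretation satisfying $\mathcal{T}$; a formula is $\mathcal{T}$-satisfiable if some $\mathcal{T}$-interpretation satisfies it; two formulas are $\mathcal{T}$-equivalent if every $\mathcal{T}$-interpretation satisfies one if and only if it satisfies the other. We write $\mathit{vars}(\varphi)$ for the set of free variables of $\varphi$ and $\mathit{vars}_\sigma(\varphi)$ for those of sort $\sigma$. Let $S\subseteq\mathcal{S}_\Sigma$. - $\mathcal{T}$ is *stably infinite* with respect to $S$ if every $\mathcal{T}$-satisfiable quantifier-free formula $\varphi$ is satisfied by a $\mathcal{T}$-interpretation $\mathcal{A}$ with $|\sigma^{\mathcal{A}}|\ge\aleph_0$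 for every $\sigma\in S$. - $\mathcal{T}$ is *smooth* with respect to $S$ if for every quantifier-free formula $\varphi$, every $\mathcal{T}$-interpretation $\mathcal{A}$ satisfying $\varphi$, and every function $\kappa$ from $S$ to the class of cardinals with $\kappa(\sigma)\ge|\sigma^{\mathcal{A}}|$ for every $\sigma\in S$, there is a $\mathcal{T}$-interpretation $\mathcal{B}$ satisfying $\varphi$ with $|\sigma^{\mathcal{B}}|=\kappa(\sigma)$ for every $\sigma\in S$. - For a finite set $V$ of variables with sorts in $S$, and equivalence relations $E_\sigma$ on the sets $V_\sigma$ of variables of sort $\sigma$ in $V$, the induced *arrangement* $\delta_V$ is the conjunction, over all $\sigma$ and all $x,y\in V_\sigma$, of $x=y$ if $x\mathrel{E_\sigma}y$ and of $\neg(x=y)$ otherwise. - $\mathcal{T}$ is *strongly finitely witnessable* with respect to $S$ if there is a computable function $\mathit{wit}$ from the quantifier-free formulas to themselves such that for every quantifier-free formula $\varphi$: (i) $\varphi$ and $\exists\vec{w}\,\mathit{wit}(\varphi)$ are $\mathcal{T}$-equivalent, where $\vec{w}=\mathit{vars}(\mathit{wit}(\varphi))\setminus\mathit{vars}(\varphi)$;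 and (ii) for every finite set $V$ of variables with sorts in $S$ and every arrangement $\delta_V$ on $V$, if $\mathit{wit}(\varphi)\wedge\delta_V$ is $\mathcal{T}$-satisfiable, then it is satisfied by a $\mathcal{T}$-interpretation $\mathcal{A}$ such that $\sigma^{\mathcal{A}}=\{x^{\mathcal{A}} : x\in\mathit{vars}_\sigma(\mathit{wit}(\varphi)\wedge\delta_V)\}$ for every $\sigma\in S$. Here "computable" is understood through the Gödel numbers of formulas that arise from a fixed injective numbering of the sorts and symbols of the countable signature. **Theorem.** Let $\Sigma$ be a countable many-sorted signature, with any fixed injective numbering of its sorts, function symbols and predicate symbols. Let $\mathcal{T}$ be a $\Sigma$-theory and let $S\subseteq\mathcal{S}_\Sigma$. If $\mathcal{T}$ is stably infinite and strongly finitely witnessable, both with respect to $S$, then $\mathcal{T}$ is smooth with respect to $S$. In other words, there are no *unicorn theories* over countable signatures, that is, theories that are stably infinite and strongly finitely witnessable but not smooth with respect to some $S$. This is the statement conjectured by Toledo, Zohar and Barrett. -/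

import Mathlib

/-! Many-sorted first-order logic with equality, and the properties of theories
used in theory combination: stable infiniteness, strong finite witnessability
and smoothness. -/

universe u v

namespace ManySorted

/-- A many-sorted signature: a nonempty set of sorts, function symbols with an arity
`(σ₁, …, σₙ, σ)` and predicate symbols with an arity `(σ₁, …, σₙ)`, where `n ≥ 0`.
The equality symbols are built into the formulas instead of being listed in `Preds`. -/
structure Signature where
  Sorts : Type u
  sorts_nonempty : Nonempty Sorts
  Funs : Type u
  funDom : Funs → List Sorts
  funCod : Funs → Sorts
  Preds : Type u
  predDom : Preds → List Sorts

/-- Variables: for each sort `σ` the countably many variables `⟨σ, n⟩`. -/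
abbrev Var (L : Signature.{u}) : Type u := Σ _ : L.Sorts, ℕ

/-- Terms, indexed by their sort. -/
inductive Term (L : Signature.{u}) : L.Sorts → Type u
  | var (σ : L.Sorts) (n : ℕ) : Term L σ
  | app (f : L.Funs) (args : (i : Fin (L.funDom f).length) → Term L ((L.funDom f).get i)) :
      Term L (L.funCod f)

/-- First-order formulas with named variables; the other connectives are derived. -/
inductive Formula (L : Signature.{u}) : Type u
  | falsum : Formula L
  | eq (σ : L.Sorts) (s t : Term L σ) : Formula L
  | rel (P : L.Preds) (args : (i : Fin (L.predDom P).length) → Term L ((L.predDom P).get i)) :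
      Formula L
  | imp (φ ψ : Formula L) : Formula L
  | all (σ : L.Sorts) (n : ℕ) (φ : Formula L) : Formula L

namespace Term

variable {L : Signature.{u}}

open Classical in
/-- The variables of a term. -/
noncomputable def vars : {σ : L.Sorts} → Term L σ → Finset (Var L)
  | _, var σ n => {⟨σ, n⟩}
  | _, app _ args => Finset.univ.biUnion fun i => (args i).vars

/-- The Gödel number of a term, given a numbering of the sorts and function symbols. -/
def code [Encodable L.Sorts] [Encodable L.Funs] : {σ : L.Sorts} → Term L σ → ℕ
  | _, var σ n => Nat.pair 0 (Nat.pair (Encodable.encode σ) n)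
  | _, app f args =>
      Nat.pair 1 (Nat.pair (Encodable.encode f)
        (Encodable.encode (List.ofFn fun i => (args i).code)))

end Term

namespace Formula

variable {L : Signature.{u}}

def neg (φ : Formula L) : Formula L := imp φ falsum

def verum : Formula L := neg falsum

def and (φ ψ : Formula L) : Formula L := neg (imp φ (neg ψ))

def ex (σ : L.Sorts) (n : ℕ) (φ : Formula L) : Formula L := neg (all σ n (neg φ))

/-- The conjunction of a finite list of formulas. -/
def conj (l : List (Formula L)) : Formula L := l.foldr and verum

/-- Existential quantification over a finite list of variables. -/
def exs (w : List (Var L)) (φ : Formula L) : Formula L := w.foldr (fun x ψ => ex x.1 x.2 ψ) φ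

open Classical in
/-- The free variables of a formula. -/
noncomputable def vars : Formula L → Finset (Var L)
  | falsum => ∅
  | eq _ s t => s.vars ∪ t.vars
  | rel _ args => Finset.univ.biUnion fun i => (args i).vars
  | imp φ ψ => φ.vars ∪ ψ.vars
  | all σ n φ => φ.vars.erase ⟨σ, n⟩

def IsQuantifierFree : Formula L → Prop
  | falsum => True
  | eq _ _ _ => True
  | rel _ _ => True
  | imp φ ψ => φ.IsQuantifierFree ∧ ψ.IsQuantifierFree
  | all _ _ _ => False

/-- The Gödel number of a formula, given a numbering of the symbols of the signature. -/
def code [Encodable L.Sorts] [Encodable L.Funs] [Encodable L.Preds] : Formula L → ℕ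
  | falsum => Nat.pair 0 0
  | eq σ s t => Nat.pair 1 (Nat.pair (Encodable.encode σ) (Nat.pair s.code t.code))
  | rel P args =>
      Nat.pair 2 (Nat.pair (Encodable.encode P)
        (Encodable.encode (List.ofFn fun i => (args i).code)))
  | imp φ ψ => Nat.pair 3 (Nat.pair φ.code ψ.code)
  | all σ n φ => Nat.pair 4 (Nat.pair (Encodable.encode σ) (Nat.pair n φ.code))

/-- The variables of sort `σ` that belong to the finite set `V`. -/
noncomputable def varsOfSort (V : Finset (Var L)) (σ : L.Sorts) : Finset ℕ :=
  V.preimage (fun n => (⟨σ, n⟩ : Var L)) (fun _ _ _ _ h => by simpa using h)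

theorem mem_varsOfSort {V : Finset (Var L)} {σ : L.Sorts} {n : ℕ} :
    n ∈ varsOfSort V σ ↔ (⟨σ, n⟩ : Var L) ∈ V :=
  Finset.mem_preimage

open Classical in
/-- The arrangement on the finite set of variables `V` induced by equivalence relations on the
sets `V_σ` of variables of sort `σ` in `V`: the conjunction, over the sorts `σ` occurring in `V`
and all `x, y ∈ V_σ`, of `x = y` if `x` and `y` are equivalent and of `¬ (x = y)` otherwise. -/
noncomputable def arrangement (V : Finset (Var L))
    (E : (σ : L.Sorts) → Setoid {n : ℕ // n ∈ varsOfSort V σ}) : Formula L :=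
  conj ((V.image Sigma.fst).toList.flatMap fun σ =>
    (Finset.univ : Finset ({n : ℕ // n ∈ varsOfSort V σ} × {n : ℕ // n ∈ varsOfSort V σ})).toList.map
      fun p =>
        if E σ p.1 p.2 then eq σ (Term.var σ p.1.1) (Term.var σ p.2.1)
        else neg (eq σ (Term.var σ p.1.1) (Term.var σ p.2.1)))

end Formula

/-- Quantifier-free formulas. -/
abbrev QFFormula (L : Signature.{u}) : Type u := {φ : Formula L // φ.IsQuantifierFree}

/-- Sentences: formulas without free variables. -/
abbrev Sentence (L : Signature.{u}) : Type u := {φ : Formula L // φ.vars = ∅}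

/-- A theory is a set of sentences. -/
abbrev Theory (L : Signature.{u}) : Type u := Set (Sentence L)

/-- Structures; equality is interpreted as identity. -/
structure Structure (L : Signature.{u}) where
  carrier : L.Sorts → Type v
  carrier_nonempty : ∀ σ, Nonempty (carrier σ)
  funMap : (f : L.Funs) → ((i : Fin (L.funDom f).length) → carrier ((L.funDom f).get i)) →
    carrier (L.funCod f)
  predMap : (P : L.Preds) → ((i : Fin (L.predDom P).length) → carrier ((L.predDom P).get i)) →
    Prop

/-- An assignment maps each variable of sort `σ` to an element of the domain of sort `σ`. -/
abbrev Assignment {L : Signature.{u}} (A : Structure.{u, v} L) : Type (max u v) :=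
  (σ : L.Sorts) → ℕ → A.carrier σ

open Classical in
/-- The assignment that sends the variable `⟨σ, n⟩` to `a` and otherwise agrees with `ν`. -/
noncomputable def Assignment.update {L : Signature.{u}} {A : Structure.{u, v} L}
    (ν : Assignment A) (σ : L.Sorts) (n : ℕ) (a : A.carrier σ) : Assignment A :=
  Function.update ν σ (Function.update (ν σ) n a)

/-- The value of a term. -/
def Term.eval {L : Signature.{u}} {A : Structure.{u, v} L} (ν : Assignment A) :
    {σ : L.Sorts} → Term L σ → A.carrier σ
  | _, .var σ n => ν σ n
  | _, .app f args => A.funMap f fun i => (args i).eval ν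

/-- Satisfaction of a formula in a structure under an assignment. -/
def Formula.Holds {L : Signature.{u}} {A : Structure.{u, v} L} : Assignment A → Formula L → Prop
  | _, .falsum => False
  | ν, .eq _ s t => s.eval ν = t.eval ν
  | ν, .rel P args => A.predMap P fun i => (args i).eval ν
  | ν, .imp φ ψ => φ.Holds ν → ψ.Holds ν
  | ν, .all σ n φ => ∀ a : A.carrier σ, φ.Holds (ν.update σ n a)

/-- An interpretation is a structure together with an assignment. -/
structure Interpretation (L : Signature.{u}) extends Structure.{u, v} L where
  assignment : Assignment toStructure

variable {L : Signature.{u}}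

def Interpretation.Satisfies (A : Interpretation.{u, v} L) (φ : Formula L) : Prop :=
  φ.Holds A.assignment

/-- `A` is a `T`-interpretation. -/
def Interpretation.IsModel (A : Interpretation.{u, v} L) (T : Theory L) : Prop :=
  ∀ φ ∈ T, A.Satisfies φ.1

namespace Theory

/-- `φ` is satisfied by some `T`-interpretation. -/
def Satisfiable (T : Theory L) (φ : Formula L) : Prop :=
  ∃ A : Interpretation.{u, v} L, A.IsModel T ∧ A.Satisfies φ

/-- Every `T`-interpretation satisfies `φ` if and only if it satisfies `ψ`. -/
def Equivalent (T : Theory L) (φ ψ : Formula L) : Prop :=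
  ∀ A : Interpretation.{u, v} L, A.IsModel T → (A.Satisfies φ ↔ A.Satisfies ψ)

def StablyInfinite (T : Theory L) (S : Set L.Sorts) : Prop :=
  ∀ φ : QFFormula L, Satisfiable.{u, v} T φ.1 →
    ∃ A : Interpretation.{u, v} L, A.IsModel T ∧ A.Satisfies φ.1 ∧
      ∀ σ ∈ S, Cardinal.aleph0 ≤ Cardinal.mk (A.carrier σ)

def Smooth (T : Theory L) (S : Set L.Sorts) : Prop :=
  ∀ (φ : QFFormula L) (A : Interpretation.{u, v} L), A.IsModel T → A.Satisfies φ.1 →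
    ∀ κ : S → Cardinal.{v}, (∀ σ : S, Cardinal.mk (A.carrier σ) ≤ κ σ) →
      ∃ B : Interpretation.{u, v} L, B.IsModel T ∧ B.Satisfies φ.1 ∧
        ∀ σ : S, Cardinal.mk (B.carrier σ) = κ σ

/-- A function from quantifier-free formulas to quantifier-free formulas is computable if some
partial recursive function sends the Gödel number of every `φ` to the Gödel number of `wit φ`. -/
def ComputableOnCodes [Encodable L.Sorts] [Encodable L.Funs] [Encodable L.Preds]
    (wit : QFFormula L → QFFormula L) : Prop :=
  ∃ g : ℕ →. ℕ, Nat.Partrec g ∧ ∀ φ : QFFormula L, (wit φ).1.code ∈ g φ.1.code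

open Classical in
/-- Strong finite witnessability. In the second clause `V` ranges over the finite sets of
variables whose sorts are in `S`, and every element of a domain of sort in `S` has to be the value
of a variable that occurs in `wit φ ∧ δ_V`. -/
def StronglyFinitelyWitnessable [Encodable L.Sorts] [Encodable L.Funs] [Encodable L.Preds]
    (T : Theory L) (S : Set L.Sorts) : Prop :=
  ∃ wit : QFFormula L → QFFormula L, ComputableOnCodes wit ∧ ∀ φ : QFFormula L,
    Equivalent.{u, v} T φ.1 (Formula.exs ((wit φ).1.vars \ φ.1.vars).toList (wit φ).1) ∧
    ∀ V : Finset (Var L), (∀ x ∈ V, x.1 ∈ S) →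
      ∀ E : (σ : L.Sorts) → Setoid {n : ℕ // n ∈ Formula.varsOfSort V σ},
        Satisfiable.{u, v} T ((wit φ).1.and (Formula.arrangement V E)) →
          ∃ A : Interpretation.{u, v} L, A.IsModel T ∧
            A.Satisfies ((wit φ).1.and (Formula.arrangement V E)) ∧
            ∀ σ ∈ S, ∀ a : A.carrier σ, ∃ n : ℕ,
              (⟨σ, n⟩ : Var L) ∈ ((wit φ).1.and (Formula.arrangement V E)).vars ∧
              A.assignment σ n = a

end Theory

end ManySorted

-- Stable infiniteness gives a model of `wit φ`, together with a satisfiable arrangement of its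
-- variables, whose domains of sort in `S` are infinite. There, fresh variables can take any number
-- of distinct values, and strong finite witnessability turns the resulting arrangement into a model
-- whose domains consist of exactly those values. Hence `φ` has models of all sufficiently large
-- finite sizes, independently in each sort of `S`, and `S` is finite
-- (`Theory.exists_model_card_eq`).
--
-- It remains to reach prescribed cardinals `κ σ`, several of them possibly infinite and different
-- (`exists_model_card`). Compactness easily provides at least `κ σ` elements. The difficulty is the
-- upper bound: naming many elements of a large sort may create, through Skolem functions, too many
-- elements of a smaller one. The cure is indiscernibility. Rank the sorts of infinite `κ σ` by
-- cardinality and let the finite domains grow rapidly with the rank. A term of sort `σ` then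
-- colours tuples from the sorts of higher rank with a number of colours fixed before those domains
-- are chosen, so Ramsey's theorem makes its value independent of increasing arguments there
-- (`exists_ramsey_family`, `exists_indiscernible_constants`).
--
-- An ultrafilter limit of such finite structures is then formed from the values of Skolem terms
-- only: Łoś's theorem survives (`limitStructure_holds`) and the size stays under control. By
-- indiscernibility every element of sort `σ` is the value of a term whose constants of higher rank
-- come from fixed countable sequences. As the language is countable, at most `κ σ` elements result,
-- and the distinct constants give at least as many.

universe w w' w₁ w₂

/-! ### Ramsey's theorem -/

/-- Finite Ramsey theorem for `k`-element sets. -/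
theorem Finset.exists_ramsey (k : ℕ) (C : Type*) [Finite C] (m : ℕ) :
    ∃ N : ℕ, ∀ X : Finset ℕ, N ≤ X.card → ∀ χ : Finset ℕ → C, ∃ H ⊆ X, m ≤ H.card ∧
      ∀ s ⊆ H, ∀ t ⊆ H, s.card = k → t.card = k → χ s = χ t := by
  classical
  induction k generalizing m with
  | zero =>
    refine ⟨m, fun X hX χ => ⟨X, subset_rfl, hX, fun s _ t _ hs ht => ?_⟩⟩
    rw [Finset.card_eq_zero.1 hs, Finset.card_eq_zero.1 ht]
  | succ k ih =>
    -- Least elements are picked greedily, so that the colour of a `(k + 1)`-set depends on its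
    -- minimum alone.
    have pre : ∀ M : ℕ, ∃ N : ℕ, ∀ X : Finset ℕ, N ≤ X.card → ∀ χ : Finset ℕ → C,
        ∃ H ⊆ X, M ≤ H.card ∧ ∃ c : ℕ → C, ∀ x ∈ H, ∀ s ⊆ H, s.card = k → (∀ y ∈ s, x < y) →
          χ (insert x s) = c x := by
      intro M
      induction M with
      | zero =>
        rcases isEmpty_or_nonempty C with hC | ⟨⟨c⟩⟩
        · exact ⟨0, fun X _ χ => (hC.false (χ ∅)).elim⟩
        · exact ⟨0, fun X _ χ => ⟨∅, by simp, by simp, fun _ => c, by simp⟩⟩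
      | succ M ihM =>
        obtain ⟨N₁, hN₁⟩ := ihM
        -- At least `k` elements must survive, so that some `k`-set `s₀` exhibits the colour
        -- attached to the new minimum.
        obtain ⟨N, hN⟩ := ih (max N₁ k)
        refine ⟨N + 1, fun X hX χ => ?_⟩
        have hne : X.Nonempty := Finset.card_pos.1 (by omega)
        set x := X.min' hne with hx
        obtain ⟨Y, hYX, hYcard, hY⟩ := hN (X.erase x)
          (by rw [Finset.card_erase_of_mem (X.min'_mem hne)]; omega) fun s => χ (insert x s)
        have hxlt : ∀ y ∈ Y, x < y := fun y hy =>
          lt_of_le_of_ne (X.min'_le y (Finset.mem_of_mem_erase (hYX hy)))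
            (Finset.ne_of_mem_erase (hYX hy)).symm
        obtain ⟨H, hHY, hHcard, c, hc⟩ := hN₁ Y (le_trans (le_max_left _ _) hYcard) χ
        obtain ⟨s₀, hs₀, hs₀card⟩ := Finset.exists_subset_card_eq
          (le_trans (le_max_right _ _) hYcard : k ≤ Y.card)
        have hxH : x ∉ H := fun h => lt_irrefl _ (hxlt x (hHY h))
        refine ⟨insert x H, ?_, ?_, fun y => if y = x then χ (insert x s₀) else c y, ?_⟩
        · intro y hy
          rcases Finset.mem_insert.1 hy with rfl | hy
          · exact X.min'_mem hne
          · exact Finset.mem_of_mem_erase (hYX (hHY hy))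
        · rw [Finset.card_insert_of_notMem hxH]
          omega
        · intro y hy s hs hsk hys
          have hxs : x ∉ s := by
            intro hxs
            have := hys x hxs
            rcases Finset.mem_insert.1 hy with rfl | hy
            · exact lt_irrefl _ this
            · exact lt_asymm this (hxlt y (hHY hy))
          have hsH : s ⊆ H := fun z hz => by
            rcases Finset.mem_insert.1 (hs hz) with rfl | h
            · exact absurd hz hxs
            · exact h
          rcases Finset.mem_insert.1 hy with rfl | hyH
          · simp only [if_true]
            exact hY s (hsH.trans hHY) s₀ hs₀ hsk hs₀card
          · simp only [if_neg (show y ≠ x by rintro rfl; exact hxH hyH)]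
            exact hc y hyH s hsH hsk hys
    cases nonempty_fintype C
    -- Pigeonhole: `m` of these elements impose the same colour as minima.
    obtain ⟨N, hN⟩ := pre (Fintype.card C * m)
    refine ⟨N, fun X hX χ => ?_⟩
    have : Nonempty C := ⟨χ ∅⟩
    obtain ⟨H, hHX, hHcard, c, hc⟩ := hN X hX χ
    obtain ⟨b, -, hb⟩ := Finset.exists_le_card_fiber_of_mul_le_card_of_maps_to
      (s := H) (t := Finset.univ) (f := c) (n := m) (fun _ _ => Finset.mem_univ _)
      Finset.univ_nonempty hHcard
    have key : ∀ s ⊆ H.filter (fun x => c x = b), s.card = k + 1 → χ s = b := by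
      intro s hs hsk
      have hne : s.Nonempty := Finset.card_pos.1 (by omega)
      have hmin := s.min'_mem hne
      have h := hc (s.min' hne) (Finset.mem_of_mem_filter _ (hs hmin)) (s.erase (s.min' hne))
        (fun y hy => Finset.mem_of_mem_filter _ (hs (Finset.mem_of_mem_erase hy)))
        (by rw [Finset.card_erase_of_mem hmin, hsk]; rfl)
        (fun y hy => lt_of_le_of_ne (s.min'_le y (Finset.mem_of_mem_erase hy))
          (Finset.ne_of_mem_erase hy).symm)
      rw [Finset.insert_erase hmin] at h
      rw [h]
      exact (Finset.mem_filter.1 (hs hmin)).2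
    exact ⟨H.filter fun x => c x = b, (Finset.filter_subset _ _).trans hHX, hb,
      fun s hs t ht hsk htk => (key s hs hsk).trans (key t ht htk).symm⟩

/-- Ramsey's theorem for strictly increasing `d`-tuples. -/
theorem exists_ramsey_strictMono (d : ℕ) (C : Type*) [Finite C] (m : ℕ) :
    ∃ N : ℕ, m ≤ N ∧ ∀ χ : (Fin d → ℕ) → C, ∃ H ⊆ Finset.range N, m ≤ H.card ∧
      ∀ u v : Fin d → ℕ, StrictMono u → StrictMono v → (∀ i, u i ∈ H) → (∀ i, v i ∈ H) →
        χ u = χ v := by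
  classical
  obtain ⟨N, hN⟩ := Finset.exists_ramsey d C m
  refine ⟨max m N, le_max_left _ _, fun χ => ?_⟩
  obtain ⟨H, hH, hcard, h⟩ := hN (Finset.range (max m N)) (by simp) fun s =>
    χ fun i => if hs : s.card = d then s.orderEmbOfFin hs i else 0
  refine ⟨H, hH, hcard, fun u v hu hv huH hvH => ?_⟩
  have key : ∀ u : Fin d → ℕ, StrictMono u →
      (Finset.univ.image u).card = d ∧
      (fun i => if hs : (Finset.univ.image u).card = d then
        (Finset.univ.image u).orderEmbOfFin hs i else 0) = u := by
    intro u hu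
    have hc : (Finset.univ.image u).card = d := by
      rw [Finset.card_image_of_injective _ hu.injective, Finset.card_univ, Fintype.card_fin]
    refine ⟨hc, ?_⟩
    simp only [hc, dif_pos]
    exact (Finset.orderEmbOfFin_unique hc (fun i => by simp) hu).symm
  have := h (Finset.univ.image u) (by intro x hx; simp at hx; obtain ⟨i, rfl⟩ := hx; exact huH i)
    (Finset.univ.image v) (by intro x hx; simp at hx; obtain ⟨i, rfl⟩ := hx; exact hvH i)
    (key u hu).1 (key v hv).1
  rwa [(key u hu).2, (key v hv).2] at this

/-- Ramsey's theorem for families of finite linear orders of rapidly increasing sizes: the functions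
`F j`, whose values are bounded by the size of the order number `s j`, become independent of their
arguments in the orders of larger number, as long as these arguments are increasing sequences in
suitable large sets. -/
theorem exists_ramsey_family {J : Type*} [Finite J] (s : J → ℕ) (d m : ℕ) (b : ℕ → ℕ)
    (hm : d ≤ m) (r : ℕ) :
    ∃ n : ℕ → ℕ, (∀ τ < r, b τ ≤ n τ) ∧ (∀ τ, r ≤ τ → n τ = 1) ∧
      ∀ F : J → (ℕ → Fin d → ℕ) → ℕ,
        (∀ j u, (∀ τ i, u τ i < n τ) → F j u < n (s j)) →
        ∃ H : ℕ → Finset ℕ, (∀ τ < r, H τ ⊆ Finset.range (n τ) ∧ m ≤ (H τ).card) ∧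
          ∀ j u u', (∀ τ i, u τ i < n τ) → (∀ τ i, u' τ i < n τ) →
            (∀ τ, τ ≤ s j ∨ r ≤ τ → u τ = u' τ) →
            (∀ τ, s j < τ → τ < r → StrictMono (u τ) ∧ StrictMono (u' τ) ∧
              ∀ i, u τ i ∈ H τ ∧ u' τ i ∈ H τ) → F j u = F j u' := by
  induction r with
  | zero =>
    refine ⟨fun _ => 1, by simp, by simp, fun F _ => ⟨fun _ => ∅, by simp, ?_⟩⟩
    intro j u u' _ _ h _
    rw [show u = u' from funext fun τ => h τ (Or.inr (Nat.zero_le _))]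
  | succ r ih =>
    obtain ⟨n, hbn, hn1, hn⟩ := ih
    obtain ⟨B, hB⟩ : ∃ B, ∀ τ, n τ ≤ B := by
      refine ⟨max 1 ((Finset.range r).sup n), fun τ => ?_⟩
      by_cases hτ : τ < r
      · exact le_trans (Finset.le_sup (f := n) (Finset.mem_range.2 hτ)) (le_max_right _ _)
      · rw [hn1 τ (not_lt.1 hτ)]
        exact le_max_left _ _
    -- The top order is chosen after the lower ones. The colour of a tuple in it is the whole table
    -- of values of all `F j` at all lower arguments, and `B` makes the set of tables finite.
    obtain ⟨N, hmN, hN⟩ := exists_ramsey_strictMono d (J → (Fin r → Fin d → Fin B) → Fin (B + 1))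
      (max m (b r))
    refine ⟨Function.update n r N, fun τ hτ => ?_, fun τ hτ => ?_, fun F hF => ?_⟩
    · by_cases h : τ = r
      · subst h
        simpa using le_trans (le_max_right _ _) hmN
      · simpa [h] using hbn τ (by omega)
    · rw [Function.update_of_ne (by omega)]
      exact hn1 τ (by omega)
    classical
    -- Reduction modulo `B + 1` loses nothing if `s j < r`, the only case in which the colour is
    -- used.
    obtain ⟨Hr, hHr, hHrcard, hcol⟩ := hN fun e j w =>
      Fin.ofNat (B + 1) (F j fun τ i => if h : τ < r then w ⟨τ, h⟩ i else if τ = r then e i else 0)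
    have hmH : m ≤ Hr.card := le_trans (le_max_left _ _) hHrcard
    obtain ⟨e, he, heH⟩ : ∃ e : Fin d → ℕ, StrictMono e ∧ ∀ i, e i ∈ Hr :=
      ⟨fun i => Hr.orderEmbOfFin rfl (Fin.castLE (hm.trans hmH) i),
        fun i j h => (Hr.orderEmbOfFin rfl).strictMono h, fun i => Hr.orderEmbOfFin_mem rfl _⟩
    have bound : ∀ u : ℕ → Fin d → ℕ, (∀ τ i, u τ i < n τ) → ∀ e : Fin d → ℕ, (∀ i, e i ∈ Hr) →
        ∀ τ i, Function.update u r e τ i < Function.update n r N τ := by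
      intro u hu e he τ i
      by_cases h : τ = r
      · subst h
        simpa using Finset.mem_range.1 (hHr (he i))
      · simpa [h] using hu τ i
    have top : ∀ j u, s j < r → (∀ τ i, u τ i < n τ) → ∀ e e' : Fin d → ℕ, StrictMono e →
        StrictMono e' → (∀ i, e i ∈ Hr) → (∀ i, e' i ∈ Hr) →
        F j (Function.update u r e) = F j (Function.update u r e') := by
      intro j u hj hu e e' he he' heH heH'
      have h := congrFun (congrFun (hcol e e' he he' heH heH') j)
        fun τ i => ⟨u τ i, lt_of_lt_of_le (hu τ i) (hB τ)⟩
      have huu : ∀ e : Fin d → ℕ, (fun τ i => if h : τ < r then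
          ((fun (τ : Fin r) i => (⟨u τ i, lt_of_lt_of_le (hu τ i) (hB τ)⟩ : Fin B)) ⟨τ, h⟩ i : ℕ)
          else if τ = r then e i else 0) = Function.update u r e := by
        intro e
        funext τ i
        rcases lt_trichotomy τ r with h | h | h
        · simp [h, h.ne]
        · subst h; simp
        · have := hu τ i
          rw [hn1 τ h.le] at this
          simp only [not_lt.2 h.le, h.ne', dif_neg, not_false_eq_true, if_false, ne_eq,
            Function.update_of_ne]
          omega
      rw [huu, huu] at h
      have hval := congrArg Fin.val h
      have hlt : ∀ e : Fin d → ℕ, (∀ i, e i ∈ Hr) → F j (Function.update u r e) < B + 1 := by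
        intro e he
        have := hF j _ (bound u hu e he)
        rw [Function.update_of_ne hj.ne] at this
        have := hB (s j)
        omega
      simpa [Fin.ofNat, Nat.mod_eq_of_lt, hlt e heH, hlt e' heH'] using hval
    -- The top argument is frozen at `e`. The value 0 replaces the functions with `s j ≥ r`, because
    -- the old sizes are 1 from `r` on.
    obtain ⟨H, hHn, hH⟩ := hn (fun j u => if s j < r then F j (Function.update u r e) else 0) (by
      intro j u hu
      by_cases hj : s j < r
      · rw [if_pos hj]
        have := hF j _ (bound u hu e heH)
        rwa [Function.update_of_ne hj.ne] at this
      · rw [if_neg hj, hn1 _ (not_lt.1 hj)]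
        exact Nat.one_pos)
    refine ⟨Function.update H r Hr, fun τ hτ => ?_, fun j u u' hu hu' heq hmono => ?_⟩
    · by_cases h : τ = r
      · subst h
        simpa using ⟨hHr, hmH⟩
      · simpa [h] using hHn τ (by omega)
    by_cases hj : s j < r
    · have low : ∀ u : ℕ → Fin d → ℕ, (∀ τ i, u τ i < Function.update n r N τ) →
          ∀ τ i, Function.update u r 0 τ i < n τ := by
        intro u hu τ i
        by_cases h : τ = r
        · subst h
          simp [hn1 τ le_rfl]
        · simpa [h] using hu τ i
      obtain ⟨h1, h2, h3⟩ := hmono r hj (Nat.lt_succ_self r)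
      simp only [Function.update_self] at h3
      have hu1 := top j _ hj (low u hu) (u r) e h1 he (fun i => (h3 i).1) heH
      have hu2 := top j _ hj (low u' hu') (u' r) e h2 he (fun i => (h3 i).2) heH
      have hmid := hH j _ _ (low u hu) (low u' hu') (by
        rintro τ hτ
        by_cases h : τ = r
        · subst h; simp
        · simpa [h] using heq τ (by omega)) (by
        intro τ h1 h2
        have := hmono τ h1 (by omega)
        simpa [h2.ne] using this)
      simp only [if_pos hj] at hmid
      simp only [Function.update_idem, Function.update_eq_self] at hu1 hu2 hmid
      rw [hu1, hu2, hmid]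
    · rw [show u = u' from funext fun τ => heq τ (by omega)]

namespace ManySorted

variable {L : Signature.{u}}

/-! ### Semantics of formulas -/

theorem Term.eval_congr {A : Structure.{u, v} L} {ν ν' : Assignment A} {σ : L.Sorts}
    (t : Term L σ) (h : ∀ x ∈ t.vars, ν x.1 x.2 = ν' x.1 x.2) : t.eval ν = t.eval ν' := by
  induction t with
  | var σ n => exact h ⟨σ, n⟩ (by simp [Term.vars])
  | app f args ih =>
    simp only [Term.eval]
    congr 1
    funext i
    exact ih i fun x hx => h x (by
      simp only [Term.vars, Finset.mem_biUnion, Finset.mem_univ, true_and]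
      exact ⟨i, hx⟩)

theorem Assignment.update_apply {A : Structure.{u, v} L} (ν : Assignment A) (σ : L.Sorts) (n : ℕ)
    (a : A.carrier σ) : ν.update σ n a σ n = a := by
  simp [Assignment.update]

theorem Assignment.update_apply_of_ne {A : Structure.{u, v} L} (ν : Assignment A) {σ : L.Sorts}
    {n : ℕ} (a : A.carrier σ) {x : Var L} (h : x ≠ ⟨σ, n⟩) :
    ν.update σ n a x.1 x.2 = ν x.1 x.2 := by
  obtain ⟨τ, m⟩ := x
  by_cases hτ : τ = σ
  · subst hτ
    have hm : m ≠ n := by rintro rfl; exact h rfl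
    simp [Assignment.update, hm]
  · simp [Assignment.update, hτ]

/-- The truth value of a formula depends on the values of its free variables only. -/
theorem Formula.holds_congr {A : Structure.{u, v} L} (φ : Formula L) {ν ν' : Assignment A}
    (h : ∀ x ∈ φ.vars, ν x.1 x.2 = ν' x.1 x.2) : φ.Holds ν ↔ φ.Holds ν' := by
  induction φ generalizing ν ν' with
  | falsum => rfl
  | eq σ s t =>
    simp only [Formula.Holds]
    rw [s.eval_congr fun x hx => h x (by simp [Formula.vars, hx]),
      t.eval_congr fun x hx => h x (by simp [Formula.vars, hx])]
  | rel P args =>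
    simp only [Formula.Holds]
    rw [show (fun i => (args i).eval ν) = fun i => (args i).eval ν' from funext fun i =>
      (args i).eval_congr fun x hx => h x (by
        simp only [Formula.vars, Finset.mem_biUnion, Finset.mem_univ, true_and]
        exact ⟨i, hx⟩)]
  | imp φ ψ ihφ ihψ =>
    simp only [Formula.Holds]
    rw [ihφ fun x hx => h x (by simp [Formula.vars, hx]),
      ihψ fun x hx => h x (by simp [Formula.vars, hx])]
  | all σ n φ ih =>
    simp only [Formula.Holds]
    refine forall_congr' fun a => ih fun x hx => ?_
    by_cases hxn : x = ⟨σ, n⟩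
    · subst hxn
      simp [Assignment.update_apply]
    · rw [ν.update_apply_of_ne a hxn, ν'.update_apply_of_ne a hxn]
      exact h x (by simp [Formula.vars, hx, hxn])

theorem Formula.holds_of_vars_eq_empty {A : Structure.{u, v} L} {φ : Formula L}
    (hφ : φ.vars = ∅) (ν ν' : Assignment A) : φ.Holds ν ↔ φ.Holds ν' :=
  φ.holds_congr (by simp [hφ])

section connectives

variable {A : Structure.{u, v} L} {ν : Assignment A} {φ ψ : Formula L}

theorem Formula.holds_and : (φ.and ψ).Holds ν ↔ φ.Holds ν ∧ ψ.Holds ν := by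
  simp only [Formula.and, Formula.neg, Formula.Holds]
  tauto

theorem Formula.holds_ex {σ : L.Sorts} {n : ℕ} :
    (Formula.ex σ n φ).Holds ν ↔ ∃ a, φ.Holds (ν.update σ n a) := by
  simp only [Formula.ex, Formula.neg, Formula.Holds]
  simp only [imp_false, not_forall, not_not]

theorem Formula.holds_conj {l : List (Formula L)} :
    (Formula.conj l).Holds ν ↔ ∀ χ ∈ l, χ.Holds ν := by
  induction l with
  | nil => simp [Formula.conj, Formula.verum, Formula.neg, Formula.Holds]
  | cons χ l ih =>
    have : Formula.conj (χ :: l) = χ.and (Formula.conj l) := rfl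
    rw [this, Formula.holds_and, ih]
    simp

theorem Formula.holds_exs {w : List (Var L)} :
    (Formula.exs w φ).Holds ν ↔
      ∃ ν' : Assignment A, (∀ x ∉ w, ν' x.1 x.2 = ν x.1 x.2) ∧ φ.Holds ν' := by
  induction w generalizing ν with
  | nil =>
    refine ⟨fun h => ⟨ν, by simp, h⟩, ?_⟩
    rintro ⟨ν', h, h'⟩
    exact (φ.holds_congr fun x _ => h x (by simp)).1 h'
  | cons y w ih =>
    have : Formula.exs (y :: w) φ = Formula.ex y.1 y.2 (Formula.exs w φ) := rfl
    rw [this, Formula.holds_ex]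
    constructor
    · rintro ⟨a, ha⟩
      obtain ⟨ν', h, h'⟩ := ih.1 ha
      refine ⟨ν', fun x hx => ?_, h'⟩
      simp only [List.mem_cons, not_or] at hx
      rw [h x hx.2, ν.update_apply_of_ne a hx.1]
    · rintro ⟨ν', h, h'⟩
      refine ⟨ν' y.1 y.2, ih.2 ⟨ν', fun x hx => ?_, h'⟩⟩
      by_cases hxy : x = y
      · subst hxy
        rw [Assignment.update_apply]
      · rw [ν.update_apply_of_ne _ hxy, h x (by simp [hxy, hx])]

end connectives

open Classical in
theorem Formula.vars_and (φ ψ : Formula L) : (φ.and ψ).vars = φ.vars ∪ ψ.vars := by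
  simp [Formula.and, Formula.neg, Formula.vars]

open Classical in
theorem Formula.vars_ex (σ : L.Sorts) (n : ℕ) (φ : Formula L) :
    (Formula.ex σ n φ).vars = φ.vars.erase ⟨σ, n⟩ := by
  simp [Formula.ex, Formula.neg, Formula.vars]

open Classical in
theorem Formula.mem_vars_exs {w : List (Var L)} {φ : Formula L} {x : Var L} :
    x ∈ (Formula.exs w φ).vars ↔ x ∈ φ.vars ∧ x ∉ w := by
  induction w with
  | nil => simp [Formula.exs]
  | cons y w ih =>
    have : Formula.exs (y :: w) φ = Formula.ex y.1 y.2 (Formula.exs w φ) := rfl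
    rw [this, Formula.vars_ex, Finset.mem_erase, ih]
    simp only [List.mem_cons, not_or]
    tauto

theorem Formula.vars_exs_toList (φ : Formula L) : (Formula.exs φ.vars.toList φ).vars = ∅ := by
  ext x
  simp [Formula.mem_vars_exs]

open Classical in
theorem Formula.mem_vars_conj {l : List (Formula L)} {x : Var L} :
    x ∈ (Formula.conj l).vars ↔ ∃ χ ∈ l, x ∈ χ.vars := by
  induction l with
  | nil => simp [Formula.conj, Formula.verum, Formula.neg, Formula.vars]
  | cons χ l ih =>
    have : Formula.conj (χ :: l) = χ.and (Formula.conj l) := rfl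
    rw [this, Formula.vars_and, Finset.mem_union, ih]
    simp

theorem Formula.IsQuantifierFree.and {φ ψ : Formula L} (hφ : φ.IsQuantifierFree)
    (hψ : ψ.IsQuantifierFree) : (φ.and ψ).IsQuantifierFree := by
  simp [Formula.and, Formula.neg, Formula.IsQuantifierFree, hφ, hψ]

theorem Formula.isQuantifierFree_conj {l : List (Formula L)}
    (h : ∀ χ ∈ l, χ.IsQuantifierFree) : (Formula.conj l).IsQuantifierFree := by
  induction l with
  | nil => simp [Formula.conj, Formula.verum, Formula.neg, Formula.IsQuantifierFree]
  | cons χ l ih =>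
    exact Formula.IsQuantifierFree.and (h χ (by simp)) (ih fun χ' h' => h χ' (by simp [h']))

/-! ### Arrangements -/

section arrangement

variable {V : Finset (Var L)} {E : (σ : L.Sorts) → Setoid {n : ℕ // n ∈ Formula.varsOfSort V σ}}

open Classical in
theorem Formula.mem_arrangement_list {χ : Formula L} :
    χ ∈ ((V.image Sigma.fst).toList.flatMap fun σ =>
      (Finset.univ : Finset ({n : ℕ // n ∈ Formula.varsOfSort V σ} ×
          {n : ℕ // n ∈ Formula.varsOfSort V σ})).toList.map
        fun p =>
          if E σ p.1 p.2 then Formula.eq σ (Term.var σ p.1.1) (Term.var σ p.2.1)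
          else Formula.neg (Formula.eq σ (Term.var σ p.1.1) (Term.var σ p.2.1))) ↔
    ∃ (σ : L.Sorts) (m n : {n : ℕ // n ∈ Formula.varsOfSort V σ}), χ =
      if E σ m n then Formula.eq σ (Term.var σ m.1) (Term.var σ n.1)
        else Formula.neg (Formula.eq σ (Term.var σ m.1) (Term.var σ n.1)) := by
  simp only [List.mem_flatMap, Finset.mem_toList, List.mem_map, Finset.mem_univ, true_and,
    Prod.exists, Finset.mem_image]
  constructor
  · rintro ⟨σ, -, m, n, rfl⟩
    exact ⟨σ, m, n, rfl⟩
  · rintro ⟨σ, m, n, rfl⟩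
    exact ⟨σ, ⟨⟨σ, m.1⟩, Formula.mem_varsOfSort.1 m.2, rfl⟩, m, n, rfl⟩

theorem Formula.isQuantifierFree_arrangement : (Formula.arrangement V E).IsQuantifierFree := by
  refine Formula.isQuantifierFree_conj fun χ hχ => ?_
  obtain ⟨σ, m, n, rfl⟩ := Formula.mem_arrangement_list.1 hχ
  split_ifs <;> simp [Formula.neg, Formula.IsQuantifierFree]

/-- The conjunction includes the diagonal pairs, so a variable that is alone in its sort still
occurs. -/
theorem Formula.vars_arrangement : (Formula.arrangement V E).vars = V := by
  ext x
  rw [Formula.arrangement, Formula.mem_vars_conj]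
  constructor
  · rintro ⟨χ, hχ, hx⟩
    obtain ⟨σ, m, n, rfl⟩ := Formula.mem_arrangement_list.1 hχ
    have : x = ⟨σ, m.1⟩ ∨ x = ⟨σ, n.1⟩ := by
      split_ifs at hx <;> simpa [Formula.neg, Formula.vars, Term.vars] using hx
    rcases this with rfl | rfl
    · exact Formula.mem_varsOfSort.1 m.2
    · exact Formula.mem_varsOfSort.1 n.2
  · intro hx
    refine ⟨_, Formula.mem_arrangement_list.2
      ⟨x.1, ⟨x.2, Formula.mem_varsOfSort.2 hx⟩, ⟨x.2, Formula.mem_varsOfSort.2 hx⟩, rfl⟩, ?_⟩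
    rw [if_pos ((E x.1).refl _)]
    simp [Formula.vars, Term.vars]

theorem Formula.holds_arrangement {A : Structure.{u, v} L} {ν : Assignment A} :
    (Formula.arrangement V E).Holds ν ↔
      ∀ (σ : L.Sorts) (m n : {n : ℕ // n ∈ Formula.varsOfSort V σ}),
        E σ m n ↔ ν σ m.1 = ν σ n.1 := by
  rw [Formula.arrangement, Formula.holds_conj]
  constructor
  · intro h σ m n
    have := h _ (Formula.mem_arrangement_list.2 ⟨σ, m, n, rfl⟩)
    split_ifs at this with hE
    · exact ⟨fun _ => this, fun _ => hE⟩
    · exact ⟨fun h => absurd h hE, fun h => absurd h this⟩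
  · intro h χ hχ
    obtain ⟨σ, m, n, rfl⟩ := Formula.mem_arrangement_list.1 hχ
    split_ifs with hE
    · exact (h σ m n).1 hE
    · exact fun h' => hE ((h σ m n).2 h')

/-- The arrangement of `V` realised by an assignment. -/
def Formula.kernel {A : Structure.{u, v} L} (ν : Assignment A) (V : Finset (Var L))
    (σ : L.Sorts) : Setoid {n : ℕ // n ∈ Formula.varsOfSort V σ} :=
  Setoid.comap (fun n => ν σ n.1) ⊥

theorem Formula.holds_arrangement_kernel {A : Structure.{u, v} L} (ν : Assignment A) :
    (Formula.arrangement V (Formula.kernel ν V)).Holds ν :=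
  Formula.holds_arrangement.2 fun _ _ _ => Iff.rfl

open Classical in
/-- Assignments that realise the same arrangement take the same number of values. -/
theorem Formula.card_image_eq_of_holds_arrangement {A B : Structure.{u, v} L} {ν : Assignment A}
    {μ : Assignment B} (hν : (Formula.arrangement V E).Holds ν)
    (hμ : (Formula.arrangement V E).Holds μ) (σ : L.Sorts) :
    ((Formula.varsOfSort V σ).image (ν σ)).card = ((Formula.varsOfSort V σ).image (μ σ)).card := by
  have key : ∀ {A B : Structure.{u, v} L} {ν : Assignment A} {μ : Assignment B},
      (Formula.arrangement V E).Holds ν → (Formula.arrangement V E).Holds μ →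
      ((Formula.varsOfSort V σ).image (ν σ)).card ≤
        ((Formula.varsOfSort V σ).image (μ σ)).card := by
    intro A B ν μ hν hμ
    have h : ∀ a ∈ (Formula.varsOfSort V σ).image (ν σ), ∃ n ∈ Formula.varsOfSort V σ, ν σ n = a :=
      fun a ha => by simpa using ha
    choose! g hg hga using h
    refine Finset.card_le_card_of_injOn (fun a => μ σ (g a))
      (fun a ha => Finset.mem_image_of_mem _ (hg a ha)) fun a ha b hb hab => ?_
    rw [← hga a ha, ← hga b hb]
    exact (Formula.holds_arrangement.1 hν σ ⟨g a, hg a ha⟩ ⟨g b, hg b hb⟩).1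
      ((Formula.holds_arrangement.1 hμ σ ⟨g a, hg a ha⟩ ⟨g b, hg b hb⟩).2 hab)
  exact le_antisymm (key hν hμ) (key hμ hν)

end arrangement

/-! ### Finite models from strong finite witnessability -/

theorem Interpretation.IsModel.withAssignment {A : Interpretation.{u, v} L} {T : Theory L}
    (h : A.IsModel T) (ν : Assignment A.toStructure) :
    (⟨A.toStructure, ν⟩ : Interpretation.{u, v} L).IsModel T :=
  fun φ hφ => (Formula.holds_of_vars_eq_empty φ.2 _ _).1 (h φ hφ)

/-- Extend the image of `s` to an `n`-element set and let the fresh indices `N + j` enumerate all of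
it; the old values then add nothing. -/
theorem exists_realization_card_eq {X : Type*} [Infinite X] (s : Finset ℕ) (f : ℕ → X) {N n : ℕ}
    (hN : ∀ k ∈ s, k < N) (hn : ∀ t : Finset X, (↑t = f '' s) → t.card ≤ n) :
    ∃ g : ℕ → X, (∀ k < N, g k = f k) ∧
      ∃ t : Finset X, ↑t = g '' (↑s ∪ {k | ∃ j < n, k = N + j}) ∧ t.card = n := by
  classical
  obtain ⟨t, ht, htn⟩ := Infinite.exists_superset_card_eq (s.image f) n (hn _ (by simp))
  obtain ⟨e⟩ : Nonempty (t ≃ Fin n) := ⟨t.equivFinOfCardEq htn⟩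
  refine ⟨fun k => if h : N ≤ k ∧ k - N < n then e.symm ⟨k - N, h.2⟩ else f k,
    fun k hk => by simp [not_le.2 hk], t, ?_, htn⟩
  ext x
  simp only [Finset.mem_coe, Set.mem_image, Set.mem_union, Set.mem_ofPred_eq]
  constructor
  · intro hx
    refine ⟨N + e ⟨x, hx⟩, Or.inr ⟨_, (e ⟨x, hx⟩).2, rfl⟩, ?_⟩
    simp
  · rintro ⟨k, hk | ⟨j, hj, rfl⟩, rfl⟩
    · simp only [not_le.2 (hN k hk), false_and, dif_neg, not_false_eq_true]
      exact ht (Finset.mem_image_of_mem f hk)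
    · simp [hj]

open Classical in
/-- A stably infinite, strongly finitely witnessable theory has models of all sufficiently large
finite sizes of a satisfiable quantifier-free formula. -/
theorem Theory.exists_model_card_eq [Encodable L.Sorts] [Encodable L.Funs] [Encodable L.Preds]
    {T : Theory L} {S : Set L.Sorts} (hinf : Theory.StablyInfinite.{u, v} T S)
    (hwit : Theory.StronglyFinitelyWitnessable.{u, v} T S) (φ : QFFormula L)
    (A : Interpretation.{u, v} L) (hA : A.IsModel T) (hφ : A.Satisfies φ.1) :
    S.Finite ∧ ∃ m : L.Sorts → ℕ, (∀ σ ∈ S, (m σ : Cardinal) ≤ Cardinal.mk (A.carrier σ)) ∧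
      ∀ n : L.Sorts → ℕ, (∀ σ ∈ S, m σ ≤ n σ) →
        ∃ B : Interpretation.{u, v} L, B.IsModel T ∧ B.Satisfies φ.1 ∧
          ∀ σ ∈ S, Nonempty (B.carrier σ ≃ Fin (n σ)) := by
  obtain ⟨wit, -, hwit⟩ := hwit
  obtain ⟨hequiv, hsfw⟩ := hwit φ
  set ψ := (wit φ).1 with hψ
  obtain ⟨ν, -, hν⟩ := Formula.holds_exs.1 ((hequiv A hA).1 hφ)
  set V₀ := ψ.vars.filter fun x => x.1 ∈ S with hV₀
  have hV₀S : ∀ x ∈ V₀, x.1 ∈ S := fun x hx => (Finset.mem_filter.1 hx).2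
  set δ₀ := Formula.arrangement V₀ (Formula.kernel ν V₀) with hδ₀
  have hsat : Satisfiable.{u, v} T (ψ.and δ₀) :=
    ⟨⟨A.toStructure, ν⟩, hA.withAssignment ν,
      Formula.holds_and.2 ⟨hν, Formula.holds_arrangement_kernel ν⟩⟩
  -- Each domain of sort in `S` is nonempty and consists of values of variables from one finite set,
  -- so each sort of `S` occurs in that set.
  have hfin : S.Finite := by
    obtain ⟨B, -, -, hB⟩ := hsfw V₀ hV₀S _ hsat
    refine ((ψ.and δ₀).vars.image Sigma.fst).finite_toSet.subset fun σ hσ => ?_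
    obtain ⟨n, hn, -⟩ := hB σ hσ (B.carrier_nonempty σ).some
    exact Finset.mem_coe.2 (Finset.mem_image.2 ⟨_, hn, rfl⟩)
  obtain ⟨A₂, hA₂T, hA₂, hA₂inf⟩ := hinf ⟨ψ.and δ₀,
    Formula.IsQuantifierFree.and (wit φ).2 Formula.isQuantifierFree_arrangement⟩ hsat
  obtain ⟨hA₂ψ, hA₂δ⟩ := Formula.holds_and.1 hA₂
  -- The threshold is the number of values of `ν` on `V₀`: it is bounded by the domain of `A`, and
  -- `δ₀` carries it over to `A₂`.
  refine ⟨hfin, fun σ => ((Formula.varsOfSort V₀ σ).image (ν σ)).card, fun σ _ => ?_,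
    fun n hn => ?_⟩
  · rw [← Cardinal.mk_coe_finset]
    exact Cardinal.mk_subtype_le _
  obtain ⟨N, hN⟩ : ∃ N : ℕ, ∀ x ∈ ψ.vars, x.2 < N :=
    ⟨ψ.vars.sup (fun x => x.2) + 1, fun x hx =>
      Nat.lt_succ_of_le (Finset.le_sup (f := fun x : Var L => x.2) hx)⟩
  have hex : ∀ σ, ∃ g : ℕ → A₂.carrier σ, (∀ k < N, g k = A₂.assignment σ k) ∧ (σ ∈ S →
      ∃ t : Finset (A₂.carrier σ),
        ↑t = g '' (↑(Formula.varsOfSort V₀ σ) ∪ {k | ∃ j < n σ, k = N + j}) ∧ t.card = n σ) := by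
    intro σ
    by_cases hσ : σ ∈ S
    · have : Infinite (A₂.carrier σ) := Cardinal.aleph0_le_mk_iff.1 (hA₂inf σ hσ)
      obtain ⟨g, hg, ht⟩ := exists_realization_card_eq (Formula.varsOfSort V₀ σ)
        (A₂.assignment σ) (N := N) (n := n σ)
        (fun k hk => hN _ (Finset.mem_filter.1 (Formula.mem_varsOfSort.1 hk)).1) (by
          intro t ht
          rw [← Finset.coe_image, Finset.coe_inj] at ht
          rw [ht, Formula.card_image_eq_of_holds_arrangement hA₂δ
            (Formula.holds_arrangement_kernel ν)]
          exact hn σ hσ)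
      exact ⟨g, hg, fun _ => ht⟩
    · exact ⟨A₂.assignment σ, fun _ _ => rfl, fun h => absurd h hσ⟩
  choose μ hμ hμS using hex
  set V := V₀ ∪ hfin.toFinset.biUnion fun σ =>
    (Finset.range (n σ)).image fun j => (⟨σ, N + j⟩ : Var L) with hV
  have hVsort : ∀ x ∈ V, x.1 ∈ S := by
    intro x hx
    rcases Finset.mem_union.1 hx with hx | hx
    · exact hV₀S x hx
    · simp only [Finset.mem_biUnion, Set.Finite.mem_toFinset, Finset.mem_image] at hx
      obtain ⟨σ, hσ, j, -, rfl⟩ := hx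
      exact hσ
  have hVσ : ∀ σ ∈ S, (↑(Formula.varsOfSort V σ) : Set ℕ) =
      ↑(Formula.varsOfSort V₀ σ) ∪ {k | ∃ j < n σ, k = N + j} := by
    intro σ hσ
    ext k
    simp only [Finset.mem_coe, Formula.mem_varsOfSort, Set.mem_union, Set.mem_ofPred_eq, hV,
      Finset.mem_union, Finset.mem_biUnion, Set.Finite.mem_toFinset, Finset.mem_image,
      Finset.mem_range]
    refine or_congr Iff.rfl ⟨?_, ?_⟩
    · rintro ⟨τ, hτ, j, hj, h⟩
      simp only [Sigma.mk.injEq] at h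
      obtain ⟨rfl, h⟩ := h
      exact ⟨j, hj, (eq_of_heq h).symm⟩
    · rintro ⟨j, hj, rfl⟩
      exact ⟨σ, hσ, j, hj, rfl⟩
  -- The arrangement of `μ` fixes the number of values on `V` at `n σ`. Since `V` contains the
  -- variables of `ψ` with sorts in `S`, the model has no other elements in these sorts.
  obtain ⟨B, hBT, hB, hBS⟩ := hsfw V hVsort (Formula.kernel (A := A₂.toStructure) μ V)
    ⟨⟨A₂.toStructure, μ⟩, hA₂T.withAssignment μ, Formula.holds_and.2
      ⟨(Formula.holds_congr ψ fun x hx => (hμ x.1 x.2 (hN x hx)).symm).1 hA₂ψ,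
        Formula.holds_arrangement_kernel μ⟩⟩
  obtain ⟨hBψ, hBδ⟩ := Formula.holds_and.1 hB
  refine ⟨B, hBT, (hequiv B hBT).2 (Formula.holds_exs.2 ⟨_, fun _ _ => rfl, hBψ⟩),
    fun σ hσ => ?_⟩
  obtain ⟨t, ht, htn⟩ := hμS σ hσ
  rw [← hVσ σ hσ, ← Finset.coe_image, Finset.coe_inj] at ht
  have hcard := Formula.card_image_eq_of_holds_arrangement hBδ
    (Formula.holds_arrangement_kernel (A := A₂.toStructure) μ) σ
  rw [← ht, htn] at hcard
  have huniv : ∀ a, a ∈ (Formula.varsOfSort V σ).image (B.assignment σ) := by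
    intro a
    obtain ⟨k, hk, rfl⟩ := hBS σ hσ a
    refine Finset.mem_image_of_mem _ (Formula.mem_varsOfSort.2 ?_)
    rw [Formula.vars_and, Formula.vars_arrangement, Finset.mem_union] at hk
    rcases hk with hk | hk
    · exact Finset.mem_union_left _ (Finset.mem_filter.2 ⟨hk, hσ⟩)
    · exact hk
  exact ⟨(Equiv.subtypeUnivEquiv huniv).symm.trans (Finset.equivFinOfCardEq hcard)⟩

/-! ### Countability of the language -/

/-- The sigma type is needed because equal codes must first be shown to come from terms of the same
sort. -/
theorem Term.code_injective [Encodable L.Sorts] [Encodable L.Funs] {σ : L.Sorts} (s : Term L σ)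
    {τ : L.Sorts} (t : Term L τ) (h : s.code = t.code) :
    (⟨σ, s⟩ : Σ σ, Term L σ) = ⟨τ, t⟩ := by
  induction s generalizing τ with
  | var σ n =>
    cases t with
    | var τ m =>
      simp only [Term.code, Nat.pair_eq_pair, Encodable.encode_inj, true_and] at h
      obtain ⟨rfl, rfl⟩ := h
      rfl
    | app f args => simp [Term.code, Nat.pair_eq_pair] at h
  | app f args ih =>
    cases t with
    | var τ m => simp [Term.code, Nat.pair_eq_pair] at h
    | app g args' =>
      simp only [Term.code, Nat.pair_eq_pair, Encodable.encode_inj, true_and] at h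
      obtain ⟨rfl, h⟩ := h
      have h' := List.ofFn_injective h
      have : args = args' := funext fun i =>
        eq_of_heq (Sigma.mk.inj (ih i (args' i) (congrFun h' i))).2
      rw [this]

theorem Formula.code_injective [Encodable L.Sorts] [Encodable L.Funs] [Encodable L.Preds] :
    Function.Injective (Formula.code : Formula L → ℕ) := by
  have hterm : ∀ {σ : L.Sorts} {s t : Term L σ}, s.code = t.code → s = t := fun {σ s t} h =>
    eq_of_heq (Sigma.mk.inj (s.code_injective t h)).2
  intro φ
  induction φ with
  | falsum => intro ψ h; cases ψ <;> simp [Formula.code, Nat.pair_eq_pair] at h ⊢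
  | eq σ s t =>
    intro ψ h
    cases ψ <;> simp only [Formula.code, Nat.pair_eq_pair, Encodable.encode_inj] at h <;>
      try omega
    obtain ⟨-, rfl, h1, h2⟩ := h
    rw [hterm h1, hterm h2]
  | rel P args =>
    intro ψ h
    cases ψ <;> simp only [Formula.code, Nat.pair_eq_pair, Encodable.encode_inj] at h <;>
      try omega
    obtain ⟨-, rfl, h⟩ := h
    have h' := List.ofFn_injective h
    congr 1
    exact funext fun i => hterm (congrFun h' i)
  | imp φ ψ ihφ ihψ =>
    intro χ h
    cases χ <;> simp only [Formula.code, Nat.pair_eq_pair] at h <;> try omega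
    rw [ihφ h.2.1, ihψ h.2.2]
  | all σ n φ ih =>
    intro χ h
    cases χ <;> simp only [Formula.code, Nat.pair_eq_pair, Encodable.encode_inj] at h <;>
      try omega
    obtain ⟨-, rfl, rfl, h⟩ := h
    rw [ih h]

theorem Formula.countable [Encodable L.Sorts] [Encodable L.Funs] [Encodable L.Preds] :
    Countable (Formula L) :=
  Formula.code_injective.countable

/-! ### Skolem terms -/

open Classical in
/-- A Skolem function: a value of the variable `⟨σ, n⟩` that makes `ψ` true, if there is one. -/
noncomputable def Structure.skolem (A : Structure.{u, v} L) (ψ : Formula L) (σ : L.Sorts) (n : ℕ)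
    (ν : Assignment A) : A.carrier σ :=
  if h : ∃ a, ψ.Holds (ν.update σ n a) then h.choose else (A.carrier_nonempty σ).some

theorem Structure.skolem_spec {A : Structure.{u, v} L} {ψ : Formula L} {σ : L.Sorts} {n : ℕ}
    {ν : Assignment A} (h : ∃ a, ψ.Holds (ν.update σ n a)) :
    ψ.Holds (ν.update σ n (A.skolem ψ σ n ν)) := by
  rw [Structure.skolem, dif_pos h]
  exact h.choose_spec

/-- Terms over the constants `K`, built with the function symbols and with Skolem functions for
all formulas. -/
inductive SkolemTerm (L : Signature.{u}) (K : L.Sorts → Type w) : L.Sorts → Type (max u w)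
  | const (σ : L.Sorts) (a : K σ) : SkolemTerm L K σ
  | app (f : L.Funs) (args : (i : Fin (L.funDom f).length) → SkolemTerm L K ((L.funDom f).get i)) :
      SkolemTerm L K (L.funCod f)
  | skolem (ψ : Formula L) (σ : L.Sorts) (n : ℕ)
      (args : (x : {x // x ∈ ψ.vars}) → SkolemTerm L K x.1.1) : SkolemTerm L K σ

namespace SkolemTerm

variable {K : L.Sorts → Type w} {K' : L.Sorts → Type w'}

open Classical in
/-- The value of a Skolem term. -/
noncomputable def eval (A : Structure.{u, v} L) (c : (σ : L.Sorts) → K σ → A.carrier σ) :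
    {σ : L.Sorts} → SkolemTerm L K σ → A.carrier σ
  | _, const σ a => c σ a
  | _, app f args => A.funMap f fun i => (args i).eval A c
  -- A default value off the free variables of `ψ` makes the result depend on `args` only.
  | _, skolem ψ σ n args => A.skolem ψ σ n fun τ m =>
      if h : (⟨τ, m⟩ : Var L) ∈ ψ.vars then (args ⟨⟨τ, m⟩, h⟩).eval A c
      else (A.carrier_nonempty τ).some

/-- Renaming of the constants. -/
def map (f : (σ : L.Sorts) → K σ → K' σ) : {σ : L.Sorts} → SkolemTerm L K σ → SkolemTerm L K' σ
  | _, const σ a => const σ (f σ a)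
  | _, app g args => app g fun i => (args i).map f
  | _, skolem ψ σ n args => skolem ψ σ n fun x => (args x).map f

/-- All constants of the term belong to `D`. -/
def ConstsIn (D : Set (Σ σ, K σ)) : {σ : L.Sorts} → SkolemTerm L K σ → Prop
  | _, const σ a => ⟨σ, a⟩ ∈ D
  | _, app _ args => ∀ i, (args i).ConstsIn D
  | _, skolem _ _ _ args => ∀ x, (args x).ConstsIn D

theorem ConstsIn.mono {D D' : Set (Σ σ, K σ)} (h : D ⊆ D') {σ : L.Sorts} {t : SkolemTerm L K σ}
    (ht : t.ConstsIn D) : t.ConstsIn D' := by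
  induction t with
  | const σ a => exact h ht
  | app f args ih => exact fun i => ih i (ht i)
  | skolem ψ σ n args ih => exact fun x => ih x (ht x)

theorem exists_finset_constsIn {σ : L.Sorts} (t : SkolemTerm L K σ) :
    ∃ D : Finset (Σ σ, K σ), t.ConstsIn (↑D : Set (Σ σ, K σ)) := by
  classical
  induction t with
  | const σ a => exact ⟨{⟨σ, a⟩}, by simp [ConstsIn]⟩
  | app f args ih =>
    choose D hD using ih
    refine ⟨Finset.univ.biUnion D, fun i => (hD i).mono ?_⟩
    exact_mod_cast Finset.subset_biUnion_of_mem D (Finset.mem_univ i)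
  | skolem ψ σ n args ih =>
    choose D hD using ih
    refine ⟨Finset.univ.biUnion D, fun i => (hD i).mono ?_⟩
    exact_mod_cast Finset.subset_biUnion_of_mem D (Finset.mem_univ i)

theorem eval_map (A : Structure.{u, v} L) (c : (σ : L.Sorts) → K' σ → A.carrier σ)
    (f : (σ : L.Sorts) → K σ → K' σ) {σ : L.Sorts} (t : SkolemTerm L K σ) :
    (t.map f).eval A c = t.eval A fun σ a => c σ (f σ a) := by
  induction t with
  | const σ a => rfl
  | app g args ih => simp only [map, eval, ih]
  | skolem ψ σ n args ih => simp only [map, eval, ih]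

theorem eval_congr (A : Structure.{u, v} L) {c c' : (σ : L.Sorts) → K σ → A.carrier σ}
    {D : Set (Σ σ, K σ)} (h : ∀ σ a, (⟨σ, a⟩ : Σ σ, K σ) ∈ D → c σ a = c' σ a) {σ : L.Sorts}
    {t : SkolemTerm L K σ} (ht : t.ConstsIn D) : t.eval A c = t.eval A c' := by
  induction t with
  | const σ a => exact h σ a ht
  | app g args ih => simp only [eval, ih _ (ht _)]
  | skolem ψ σ n args ih => simp only [eval, ih _ (ht _)]

/-- A term whose constants are in the image of a renaming is itself a renamed term. -/
theorem ConstsIn.exists_map_eq {D : Set (Σ σ, K' σ)} {f : (σ : L.Sorts) → K σ → K' σ}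
    (hf : ∀ σ a, (⟨σ, a⟩ : Σ σ, K' σ) ∈ D → ∃ b, f σ b = a) {σ : L.Sorts}
    {t : SkolemTerm L K' σ} (ht : t.ConstsIn D) : ∃ t' : SkolemTerm L K σ, t'.map f = t := by
  induction t with
  | const σ a =>
    obtain ⟨b, rfl⟩ := hf σ a ht
    exact ⟨const σ b, rfl⟩
  | app g args ih =>
    choose t' ht' using fun i => ih i (ht i)
    exact ⟨app g t', by simp only [map, ht']⟩
  | skolem ψ σ n args ih =>
    choose t' ht' using fun i => ih i (ht i)
    exact ⟨skolem ψ σ n t', by simp only [map, ht']⟩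

theorem map_map {K'' : L.Sorts → Type*} (f : (σ : L.Sorts) → K σ → K' σ)
    (g : (σ : L.Sorts) → K' σ → K'' σ) {σ : L.Sorts} (t : SkolemTerm L K σ) :
    (t.map f).map g = t.map fun σ a => g σ (f σ a) := by
  induction t with
  | const σ a => rfl
  | app g args ih => simp only [map, ih]
  | skolem ψ σ n args ih => simp only [map, ih]

/-- The symbols from which Skolem terms are built. -/
abbrev Symbol (L : Signature.{u}) (K : L.Sorts → Type w) : Type (max u w) :=
  (Σ σ, K σ) ⊕ (L.Funs ⊕ (Formula L × L.Sorts × ℕ))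

/-- The argument positions of a symbol. -/
def Symbol.Arg : Symbol L K → Type u
  | .inl _ => PEmpty
  | .inr (.inl f) => ULift (Fin (L.funDom f).length)
  | .inr (.inr p) => {x // x ∈ p.1.vars}

instance Symbol.finite_arg : ∀ s : Symbol L K, Finite s.Arg
  | .inl _ => inferInstanceAs (Finite PEmpty)
  | .inr (.inl f) => inferInstanceAs (Finite (ULift (Fin (L.funDom f).length)))
  | .inr (.inr p) => inferInstanceAs (Finite {x // x ∈ p.1.vars})

/-- The tree of a Skolem term. -/
def toTree : {σ : L.Sorts} → SkolemTerm L K σ → WType (Symbol.Arg (L := L) (K := K))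
  | _, const σ a => ⟨.inl ⟨σ, a⟩, PEmpty.elim⟩
  | _, app f args => ⟨.inr (.inl f), fun i => (args i.down).toTree⟩
  | _, skolem ψ σ n args => ⟨.inr (.inr (ψ, σ, n)), fun x => (args x).toTree⟩

theorem toTree_injective {σ τ : L.Sorts} (s : SkolemTerm L K σ) (t : SkolemTerm L K τ)
    (h : s.toTree = t.toTree) : (⟨σ, s⟩ : Σ σ, SkolemTerm L K σ) = ⟨τ, t⟩ := by
  induction s generalizing τ with
  | const σ a =>
    cases t <;> simp only [toTree] at h <;> cases (WType.mk.inj h).1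
    rfl
  | app f args ih =>
    cases t <;> simp only [toTree] at h <;> cases (WType.mk.inj h).1
    rename_i args'
    have : args = args' := funext fun i =>
      eq_of_heq (Sigma.mk.inj (ih i _ (congrFun (eq_of_heq (WType.mk.inj h).2) ⟨i⟩))).2
    rw [this]
  | skolem ψ σ n args ih =>
    cases t <;> simp only [toTree] at h <;> cases (WType.mk.inj h).1
    rename_i args'
    have : args = args' := funext fun x =>
      eq_of_heq (Sigma.mk.inj (ih x _ (congrFun (eq_of_heq (WType.mk.inj h).2) x))).2
    rw [this]

/-- Terms are finitely branching well-founded trees labelled by symbols, and apart from the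
constants there are only countably many symbols. -/
theorem mk_le [Encodable L.Sorts] [Encodable L.Funs] [Encodable L.Preds] (σ : L.Sorts) :
    Cardinal.mk (SkolemTerm L K σ) ≤ max Cardinal.aleph0 (Cardinal.mk (Σ σ, K σ)) := by
  have : Countable (Formula L) := Formula.countable
  have h1 : Cardinal.mk (SkolemTerm L K σ) ≤ Cardinal.mk (WType (Symbol.Arg (L := L) (K := K))) :=
    Cardinal.mk_le_of_injective (f := toTree) fun s t h =>
      eq_of_heq (Sigma.mk.inj (toTree_injective s t h)).2
  refine h1.trans ((WType.cardinalMk_le_max_aleph0_of_finite').trans ?_)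
  refine max_le ?_ (le_max_left _ _)
  rw [Cardinal.lift_id'.{u, w}, Cardinal.mk_sum, Cardinal.lift_id'.{u, w}]
  refine (Cardinal.add_le_max _ _).trans (max_le (max_le (le_max_right _ _) ?_) (le_max_left _ _))
  refine le_max_of_le_left ?_
  rw [Cardinal.lift_le_aleph0]
  exact Cardinal.mk_le_aleph0

end SkolemTerm

-- Used with `q` and with evaluation as `F`, so that both sides of Łoś's theorem pass to the same
-- updated family of terms.
open Classical in
theorem Assignment.update_comp {B : Structure.{u, v} L} {X : L.Sorts → Type w}
    (F : (σ : L.Sorts) → X σ → B.carrier σ) (g : (σ : L.Sorts) → ℕ → X σ) (σ : L.Sorts) (n : ℕ)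
    (t : X σ) :
    Assignment.update (A := B) (fun σ n => F σ (g σ n)) σ n (F σ t) =
      fun τ m => F τ (Function.update g σ (Function.update (g σ) n t) τ m) := by
  funext τ m
  by_cases hτ : τ = σ
  · subst hτ
    by_cases hm : m = n
    · subst hm
      simp [Assignment.update]
    · simp [Assignment.update, hm]
  · simp [Assignment.update, hτ]

/-! ### Reduced products of Skolem terms -/

section limit

variable {K : L.Sorts → Type w} {I : Type w₁} (U : Ultrafilter I) (A : I → Structure.{u, w₂} L)
  (c : ∀ i σ, K σ → (A i).carrier σ) {C : L.Sorts → Type v} {q : ∀ σ, SkolemTerm L K σ → C σ}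

/-- The structure whose elements are the values of Skolem terms in the structures `A i`, up to
equality on a set of the ultrafilter `U`; the map `q` presents these classes. -/
noncomputable def limitStructure (hq : ∀ σ, Function.Surjective (q σ)) : Structure.{u, v} L where
  carrier := C
  carrier_nonempty σ := ⟨q σ (.skolem .falsum σ 0 fun x => by simpa [Formula.vars] using x.2)⟩
  funMap f args := q _ (.app f fun k => Function.surjInv (hq _) (args k))
  predMap P args := ∀ᶠ i in U, (A i).predMap P fun k =>
    (Function.surjInv (hq _) (args k)).eval (A i) (c i)

/-- Substitution of Skolem terms for the variables of a term. -/
def Term.toSkolemTerm (g : (σ : L.Sorts) → ℕ → SkolemTerm L K σ) :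
    {σ : L.Sorts} → Term L σ → SkolemTerm L K σ
  | _, .var σ n => g σ n
  | _, .app f args => .app f fun i => (args i).toSkolemTerm g

theorem Term.eval_toSkolemTerm (g : (σ : L.Sorts) → ℕ → SkolemTerm L K σ)
    (B : Structure.{u, v} L) (b : ∀ σ, K σ → B.carrier σ) {σ : L.Sorts} (t : Term L σ) :
    (t.toSkolemTerm g).eval B b = t.eval (A := B) fun σ n => (g σ n).eval B b := by
  induction t with
  | var σ n => rfl
  | app f args ih => simp only [Term.toSkolemTerm, SkolemTerm.eval, Term.eval, ih]

variable (hq : ∀ σ, Function.Surjective (q σ))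
  (hker : ∀ σ s t, q σ s = q σ t ↔ ∀ᶠ i in U, s.eval (A i) (c i) = t.eval (A i) (c i))

-- The representatives chosen in `limitStructure` are harmless: a symbol has finitely many
-- arguments, so the sets on which they agree with the given terms intersect in a member of `U`.
include hker in
theorem limitStructure_eval (g : (σ : L.Sorts) → ℕ → SkolemTerm L K σ) {σ : L.Sorts}
    (t : Term L σ) :
    t.eval (A := limitStructure U A c hq) (fun σ n => q σ (g σ n)) = q σ (t.toSkolemTerm g) := by
  induction t with
  | var σ n => rfl
  | app f args ih =>
    simp only [Term.eval, ih]
    refine (hker _ _ _).2 ?_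
    have : ∀ᶠ i in U, ∀ k, (Function.surjInv (hq _) (q _ ((args k).toSkolemTerm g))).eval
        (A i) (c i) = ((args k).toSkolemTerm g).eval (A i) (c i) :=
      Filter.eventually_all.2 fun k => (hker _ _ _).1 (Function.surjInv_eq (hq _) _)
    filter_upwards [this] with i hi
    simp only [SkolemTerm.eval, hi]
    rfl

include hker in
/-- Łoś's theorem for reduced products of Skolem terms. -/
theorem limitStructure_holds (φ : Formula L) (g : (σ : L.Sorts) → ℕ → SkolemTerm L K σ) :
    φ.Holds (A := limitStructure U A c hq) (fun σ n => q σ (g σ n)) ↔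
      ∀ᶠ i in U, φ.Holds (A := A i) fun σ n => (g σ n).eval (A i) (c i) := by
  classical
  induction φ generalizing g with
  | falsum => simp [Formula.Holds, U.neBot.ne]
  | eq σ s t =>
    simp only [Formula.Holds, limitStructure_eval U A c hq hker]
    refine (hker _ _ _).trans ?_
    simp only [Term.eval_toSkolemTerm]
  | rel P args =>
    simp only [Formula.Holds, limitStructure_eval U A c hq hker]
    have : ∀ᶠ i in U, ∀ k, (Function.surjInv (hq _) (q _ ((args k).toSkolemTerm g))).eval
        (A i) (c i) = ((args k).toSkolemTerm g).eval (A i) (c i) :=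
      Filter.eventually_all.2 fun k => (hker _ _ _).1 (Function.surjInv_eq (hq _) _)
    refine Filter.eventually_congr ?_
    filter_upwards [this] with i hi
    simp only [hi, Term.eval_toSkolemTerm]
  | imp φ ψ ihφ ihψ =>
    simp only [Formula.Holds]
    rw [ihφ, ihψ, Ultrafilter.eventually_imp]
  | all σ n φ ih =>
    have hupd : ∀ t : SkolemTerm L K σ, ∃ g' : (σ : L.Sorts) → ℕ → SkolemTerm L K σ,
        Assignment.update (A := limitStructure U A c hq) (fun σ n => q σ (g σ n)) σ n (q σ t) =
          (fun σ n => q σ (g' σ n)) ∧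
        ∀ i, Assignment.update (A := A i) (fun σ n => (g σ n).eval (A i) (c i)) σ n
          (t.eval (A i) (c i)) = fun σ n => (g' σ n).eval (A i) (c i) := by
      exact fun t => ⟨Function.update g σ (Function.update (g σ) n t),
        Assignment.update_comp (B := limitStructure U A c hq) q g σ n t,
        fun i => Assignment.update_comp (fun _ s => s.eval (A i) (c i)) g σ n t⟩
    simp only [Formula.Holds]
    constructor
    · intro h
      -- This term picks a counterexample to `φ` whenever there is one; since `φ` holds at it for
      -- `U`-almost all `i`, there is none for those `i`.
      let t : SkolemTerm L K σ := .skolem φ.neg σ n fun x => g x.1.1 x.1.2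
      obtain ⟨g', h1, h2⟩ := hupd t
      have h' := h (q σ t)
      rw [h1, ih] at h'
      filter_upwards [h'] with i hi
      rw [← h2 i] at hi
      by_contra hcon
      push Not at hcon
      obtain ⟨a, ha⟩ := hcon
      let ν : Assignment (A i) := fun τ m => if _ : (⟨τ, m⟩ : Var L) ∈ φ.neg.vars then
        (g τ m).eval (A i) (c i) else ((A i).carrier_nonempty τ).some
      have hν : ∀ b, φ.Holds (Assignment.update ν σ n b) ↔ φ.Holds
          (Assignment.update (A := A i) (fun σ n => (g σ n).eval (A i) (c i)) σ n b) := by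
        intro b
        refine φ.holds_congr fun x hx => ?_
        by_cases hxn : x = ⟨σ, n⟩
        · subst hxn
          simp [Assignment.update_apply]
        · rw [Assignment.update_apply_of_ne _ _ hxn, Assignment.update_apply_of_ne _ _ hxn]
          simp only [ν]
          rw [dif_pos]
          simpa [Formula.neg, Formula.vars] using hx
      have hspec := Structure.skolem_spec (A := A i) (ψ := φ.neg) (σ := σ) (n := n) (ν := ν)
        ⟨a, fun h => ha ((hν a).1 h)⟩
      refine hspec ((hν _).2 ?_)
      exact hi
    · intro h a
      obtain ⟨t, rfl⟩ := hq σ a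
      obtain ⟨g', h1, h2⟩ := hupd t
      rw [h1, ih]
      filter_upwards [h] with i hi
      rw [← h2 i]
      exact hi _

end limit

end ManySorted

/-! ### Order-theoretic preliminaries -/

theorem Finset.exists_strictMonoOn_mem {α : Type*} [LinearOrder α] (D : Finset α) (H : Finset ℕ)
    (h : D.card ≤ H.card) (hH : H.Nonempty) :
    ∃ f : α → ℕ, (∀ a, f a ∈ H) ∧ StrictMonoOn f ↑D := by
  classical
  obtain ⟨k₀, hk₀⟩ := hH
  let e := D.orderIsoOfFin rfl
  refine ⟨fun a => if ha : a ∈ D then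
    H.orderEmbOfFin rfl (Fin.castLE h (e.symm ⟨a, ha⟩)) else k₀, fun a => ?_, ?_⟩
  · dsimp only
    split_ifs
    · exact H.orderEmbOfFin_mem rfl _
    · exact hk₀
  · intro a ha b hb hab
    have ha' : a ∈ D := ha
    have hb' : b ∈ D := hb
    simp only [ha', hb', dif_pos]
    refine (H.orderEmbOfFin rfl).strictMono ?_
    have : e.symm ⟨a, ha'⟩ < e.symm ⟨b, hb'⟩ := e.symm.strictMono hab
    exact this

theorem Finset.exists_strictMono_nat {α : Type*} [LinearOrder α] [Nonempty α] [NoMaxOrder α]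
    (D : Finset α) : ∃ f : ℕ → α, StrictMono f ∧ ∀ a ∈ D, ∃ k, f k = a := by
  classical
  obtain ⟨M, hM⟩ := D.exists_le
  obtain ⟨g, hg, hg0⟩ := Nat.exists_strictMono' M
  -- The shift by one skips `g 0 = M`, which may belong to `D`.
  refine ⟨fun k => if h : k < D.card then D.orderEmbOfFin rfl ⟨k, h⟩ else g (k - D.card + 1),
    fun i j hij => ?_, fun a ha => ?_⟩
  · dsimp only
    split_ifs with h1 h2 h2
    · exact (D.orderEmbOfFin rfl).strictMono hij
    · refine lt_of_le_of_lt (hM _ (D.orderEmbOfFin_mem rfl _)) ?_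
      rw [← hg0]
      exact hg (Nat.succ_pos _)
    · omega
    · exact hg (by omega)
  · obtain ⟨i, hi⟩ : a ∈ Set.range (D.orderEmbOfFin rfl) := by simpa using ha
    exact ⟨i, by simp [hi]⟩

/-- Sorting breaks ties arbitrarily, so the ranks are injective even where `f` is not. -/
theorem Set.Finite.exists_ranking {α β : Type*} [LinearOrder β] {s : Set α} (hs : s.Finite)
    (f : α → β) : ∃ (r : ℕ) (rk : α → ℕ), Set.InjOn rk s ∧ (∀ a ∈ s, rk a < r) ∧
      (∀ k < r, ∃ a ∈ s, rk a = k) ∧ ∀ a ∈ s, ∀ b ∈ s, rk a ≤ rk b → f a ≤ f b := by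
  classical
  have := hs.to_subtype
  obtain ⟨n, ⟨e⟩⟩ := Finite.exists_equiv_fin s
  let π := Tuple.sort fun i => f (e.symm i)
  have hπ := Tuple.monotone_sort fun i => f (e.symm i)
  refine ⟨n, fun a => if ha : a ∈ s then (π.symm (e ⟨a, ha⟩)).val else 0, ?_, ?_, ?_, ?_⟩
  · intro a ha b hb hab
    simp only [ha, hb, dif_pos, Fin.val_inj, EmbeddingLike.apply_eq_iff_eq] at hab
    exact congrArg Subtype.val hab
  · intro a ha
    simp only [ha, dif_pos]
    exact Fin.isLt _
  · intro k hk
    exact ⟨_, (e.symm (π ⟨k, hk⟩)).2, by simp⟩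
  · intro a ha b hb hab
    simp only [ha, hb, dif_pos, Fin.val_fin_le] at hab
    have h : f (e.symm (π (π.symm (e ⟨a, ha⟩)))) ≤ f (e.symm (π (π.symm (e ⟨b, hb⟩)))) := hπ hab
    simpa only [Equiv.apply_symm_apply, Equiv.symm_apply_apply] using h

namespace ManySorted

variable {L : Signature.{u}}

/-! ### Indiscernible constants in large finite structures -/

/-- An instance of indiscernibility: a term `term` whose sort belongs to `P`, and two sequences of
constants for each sort, which agree on sorts of small rank, and are increasing on the other sorts
from `P`. -/
structure Indiscernibility (K : L.Sorts → Type v) [∀ σ, LinearOrder (K σ)] (P : Set L.Sorts)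
    (rk : L.Sorts → ℕ) where
  sort : L.Sorts
  sort_mem : sort ∈ P
  term : SkolemTerm L (fun _ => ℕ) sort
  left : (σ : L.Sorts) → ℕ → K σ
  right : (σ : L.Sorts) → ℕ → K σ
  agree : ∀ σ, (σ ∈ P → rk σ ≤ rk sort) → left σ = right σ
  strictMono : ∀ σ ∈ P, rk sort < rk σ → StrictMono (left σ) ∧ StrictMono (right σ)

/-- The finitely many requirements in `R` involve finitely many constants. With the sizes of
`exists_ramsey_family`, one function per requirement, these constants are placed in increasing order
inside the homogeneous sets. -/
theorem exists_indiscernible_constants {K : L.Sorts → Type v} [∀ σ, LinearOrder (K σ)]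
    {P : Set L.Sorts} (hP : P.Finite) {rk : L.Sorts → ℕ} {r : ℕ} (hinj : Set.InjOn rk P)
    (hlt : ∀ σ ∈ P, rk σ < r) (hsurj : ∀ k < r, ∃ σ ∈ P, rk σ = k)
    (Q : Structure.{u, w} L → Prop) (m : L.Sorts → ℕ)
    (hQ : ∀ n : L.Sorts → ℕ, (∀ σ ∈ P, m σ ≤ n σ) →
      ∃ B : Structure.{u, w} L, Q B ∧ ∀ σ ∈ P, Nonempty (B.carrier σ ≃ Fin (n σ)))
    (R : Finset (Indiscernibility K P rk)) (D : Finset (Σ σ, K σ)) :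
    ∃ B : Structure.{u, w} L, Q B ∧ ∃ c : (σ : L.Sorts) → K σ → B.carrier σ,
      (∀ σ ∉ P, Nonempty (B.carrier σ ≃ K σ) → Function.Bijective (c σ)) ∧
      (∀ σ ∈ P, ∀ a b, (⟨σ, a⟩ : Σ σ, K σ) ∈ D → (⟨σ, b⟩ : Σ σ, K σ) ∈ D → c σ a = c σ b → a = b) ∧
      ∀ ρ ∈ R, (ρ.term.map ρ.left).eval B c = (ρ.term.map ρ.right).eval B c := by
  classical
  obtain ⟨d, hd⟩ : ∃ d : ℕ, ∀ ρ ∈ R, ρ.term.ConstsIn {x | x.2 < d} := by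
    choose E hE using fun ρ : Indiscernibility K P rk => ρ.term.exists_finset_constsIn
    refine ⟨R.sup (fun ρ => (E ρ).sup fun x => x.2) + 1, fun ρ hρ => (hE ρ).mono fun x hx => ?_⟩
    have h1 : x.2 ≤ (E ρ).sup fun x => x.2 :=
      Finset.le_sup (f := fun x : Σ _ : L.Sorts, ℕ => x.2) (Finset.mem_coe.1 hx)
    have h2 := Finset.le_sup (f := fun ρ => (E ρ).sup fun x => x.2) hρ
    exact Nat.lt_succ_of_le (h1.trans h2)
  let D' : (σ : L.Sorts) → Finset (K σ) := fun σ =>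
    D.preimage (Sigma.mk σ) (sigma_mk_injective.injOn) ∪ R.biUnion fun ρ =>
      (Finset.range d).image (ρ.left σ) ∪ (Finset.range d).image (ρ.right σ)
  have hD'D : ∀ σ a, (⟨σ, a⟩ : Σ σ, K σ) ∈ D → a ∈ D' σ := fun σ a h =>
    Finset.mem_union_left _ (Finset.mem_preimage.2 h)
  have hD'l : ∀ ρ ∈ R, ∀ σ, ∀ k < d, ρ.left σ k ∈ D' σ := fun ρ hρ σ k hk =>
    Finset.mem_union_right _ (Finset.mem_biUnion.2 ⟨ρ, hρ, Finset.mem_union_left _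
      (Finset.mem_image_of_mem _ (Finset.mem_range.2 hk))⟩)
  have hD'r : ∀ ρ ∈ R, ∀ σ, ∀ k < d, ρ.right σ k ∈ D' σ := fun ρ hρ σ k hk =>
    Finset.mem_union_right _ (Finset.mem_biUnion.2 ⟨ρ, hρ, Finset.mem_union_right _
      (Finset.mem_image_of_mem _ (Finset.mem_range.2 hk))⟩)
  -- The final `+ 1` in the size of the homogeneous sets keeps them nonempty even if no constant is
  -- relevant.
  obtain ⟨n, hnb, hn1, hn⟩ := exists_ramsey_family (J := {ρ // ρ ∈ R}) (fun ρ => rk ρ.1.sort) d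
    (max d (hP.toFinset.sup fun σ => (D' σ).card) + 1) (fun _ => hP.toFinset.sup m + 1)
    ((le_max_left _ _).trans (Nat.le_succ _)) r
  have hnpos : ∀ k, 0 < n k := fun k => by
    by_cases hk : k < r
    · exact lt_of_lt_of_le (Nat.succ_pos _) (hnb k hk)
    · rw [hn1 k (not_lt.1 hk)]
      exact Nat.one_pos
  obtain ⟨B, hB, e⟩ := hQ (fun σ => n (rk σ)) fun σ hσ =>
    (Finset.le_sup (f := m) (hP.mem_toFinset.2 hσ)).trans
      ((Nat.le_succ _).trans (hnb _ (hlt σ hσ)))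
  replace e : ∀ σ ∈ P, B.carrier σ ≃ Fin (n (rk σ)) := fun σ hσ => (e σ hσ).some
  let c₀ : (σ : L.Sorts) → K σ → B.carrier σ := fun σ =>
    if h : Nonempty (B.carrier σ ≃ K σ) then h.some.symm else fun _ => (B.carrier_nonempty σ).some
  -- Outside `P` the constants of `ρ.left` serve for both sequences, by `ρ.agree`.
  let val : Indiscernibility K P rk → (ℕ → Fin d → ℕ) → (σ : L.Sorts) → ℕ → B.carrier σ :=
    fun ρ x σ k => if hσ : σ ∈ P then
      (if h : ∃ h : k < d, x (rk σ) ⟨k, h⟩ < n (rk σ) then (e σ hσ).symm ⟨_, h.2⟩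
        else (B.carrier_nonempty σ).some)
      else c₀ σ (ρ.left σ k)
  obtain ⟨H, hHn, hH⟩ := hn
    (fun ρ x => (e ρ.1.sort ρ.1.sort_mem (ρ.1.term.eval B (val ρ.1 x))).val)
    (fun ρ x _ => Fin.isLt _)
  have hh : ∀ σ, ∃ h : K σ → ℕ, σ ∈ P → (∀ a, h a ∈ H (rk σ)) ∧ StrictMonoOn h ↑(D' σ) := by
    intro σ
    by_cases hσ : σ ∈ P
    · have h1 := (hHn (rk σ) (hlt σ hσ)).2
      have h2 : (D' σ).card ≤ hP.toFinset.sup fun σ => (D' σ).card :=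
        Finset.le_sup (f := fun σ => (D' σ).card) (hP.mem_toFinset.2 hσ)
      have h3 := le_max_right d (hP.toFinset.sup fun σ => (D' σ).card)
      obtain ⟨h, h'⟩ := (D' σ).exists_strictMonoOn_mem (H (rk σ)) (by omega)
        (Finset.card_pos.1 (by omega))
      exact ⟨h, fun _ => h'⟩
    · exact ⟨fun _ => 0, fun h => absurd h hσ⟩
  choose h hhH using hh
  have hhn : ∀ σ ∈ P, ∀ a, h σ a < n (rk σ) := fun σ hσ a =>
    Finset.mem_range.1 ((hHn _ (hlt σ hσ)).1 ((hhH σ hσ).1 a))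
  let c : (σ : L.Sorts) → K σ → B.carrier σ := fun σ a =>
    if hσ : σ ∈ P then (e σ hσ).symm ⟨h σ a, hhn σ hσ a⟩ else c₀ σ a
  let seq : ((σ : L.Sorts) → ℕ → K σ) → ℕ → Fin d → ℕ := fun f k i =>
    if hk : ∃ σ ∈ P, rk σ = k then h hk.choose (f hk.choose i) else 0
  have hseq : ∀ f, ∀ σ ∈ P, ∀ i, seq f (rk σ) i = h σ (f σ i) := by
    intro f σ hσ i
    have hk : ∃ τ ∈ P, rk τ = rk σ := ⟨σ, hσ, rfl⟩
    have : hk.choose = σ := hinj hk.choose_spec.1 hσ hk.choose_spec.2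
    simp only [seq, dif_pos hk]
    rw [this]
  have hseqn : ∀ f k i, seq f k i < n k := by
    intro f k i
    by_cases hk : ∃ σ ∈ P, rk σ = k
    · obtain ⟨σ, hσ, rfl⟩ := hk
      rw [hseq f σ hσ]
      exact hhn σ hσ _
    · simp only [seq, dif_neg hk]
      exact hnpos k
  have heval : ∀ ρ ∈ R, ∀ f : (σ : L.Sorts) → ℕ → K σ, (∀ σ ∉ P, f σ = ρ.left σ) →
      (ρ.term.map f).eval B c = ρ.term.eval B (val ρ (seq f)) := by
    intro ρ hρ f hf
    rw [SkolemTerm.eval_map]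
    refine SkolemTerm.eval_congr B (fun σ k hk => ?_) (hd ρ hρ)
    have hk : k < d := hk
    by_cases hσ : σ ∈ P
    · have hex : ∃ h : k < d, seq f (rk σ) ⟨k, h⟩ < n (rk σ) := ⟨hk, hseqn f _ _⟩
      simp only [c, val, dif_pos hσ, dif_pos hex]
      congr 2
      exact (hseq f σ hσ ⟨k, hk⟩).symm
    · simp only [c, val, dif_neg hσ, hf σ hσ]
  refine ⟨B, hB, c, fun σ hσ hne => ?_, fun σ hσ a b ha hb hab => ?_, fun ρ hρ => ?_⟩
  · have : c σ = hne.some.symm := by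
      funext a
      simp only [c, c₀, dif_neg hσ, dif_pos hne]
    rw [this]
    exact Equiv.bijective _
  · simp only [c, dif_pos hσ, EmbeddingLike.apply_eq_iff_eq, Fin.mk.injEq] at hab
    exact (hhH σ hσ).2.injOn (hD'D σ a ha) (hD'D σ b hb) hab
  · rw [heval ρ hρ ρ.left fun _ _ => rfl,
      heval ρ hρ ρ.right fun σ hσ => (ρ.agree σ fun h => absurd h hσ).symm]
    have := hH ⟨ρ, hρ⟩ (seq ρ.left) (seq ρ.right) (hseqn _) (hseqn _) (by
      intro k hk
      funext i
      by_cases hex : ∃ σ ∈ P, rk σ = k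
      · obtain ⟨σ, hσ, rfl⟩ := hex
        rw [hseq _ σ hσ, hseq _ σ hσ, ρ.agree σ fun _ => hk.resolve_right (hlt σ hσ).not_ge]
      · simp only [seq, dif_neg hex]) (by
      intro k hk hkr
      obtain ⟨σ, hσ, rfl⟩ := hsurj k hkr
      obtain ⟨hl, hr⟩ := ρ.strictMono σ hσ hk
      refine ⟨fun i j hij => ?_, fun i j hij => ?_, fun i => ?_⟩
      · rw [hseq _ σ hσ, hseq _ σ hσ]
        exact (hhH σ hσ).2 (hD'l ρ hρ σ i i.2) (hD'l ρ hρ σ j j.2) (hl hij)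
      · rw [hseq _ σ hσ, hseq _ σ hσ]
        exact (hhH σ hσ).2 (hD'r ρ hρ σ i i.2) (hD'r ρ hρ σ j j.2) (hr hij)
      · rw [hseq _ σ hσ, hseq _ σ hσ]
        exact ⟨(hhH σ hσ).1 _, (hhH σ hσ).1 _⟩)
    exact (e ρ.sort ρ.sort_mem).injective (Fin.val_injective this)

/-! ### Models of prescribed cardinalities -/

/-- A cardinal below a lifted one is itself a lift, so it is represented in the smaller universe. -/
theorem small_of_mk_le_lift {X : Type (max u v)} {κ : Cardinal.{v}}
    (h : Cardinal.mk X ≤ Cardinal.lift.{u} κ) : Small.{v} X := by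
  obtain ⟨κ', hκ'⟩ := Cardinal.mem_range_lift_of_le h
  rw [← Cardinal.mk_out κ'] at hκ'
  obtain ⟨e⟩ := Cardinal.lift_mk_eq'.1
    (show Cardinal.lift.{max u v} (Cardinal.mk κ'.out) = Cardinal.lift.{v} (Cardinal.mk X) by
      rw [← hκ', Cardinal.lift_lift, Cardinal.lift_umax.{v, u}])
  exact ⟨_, ⟨e.symm⟩⟩

instance SkolemTerm.small [Encodable L.Sorts] [Encodable L.Funs] [Encodable L.Preds]
    {K : L.Sorts → Type v} (σ : L.Sorts) : Small.{v} (SkolemTerm L K σ) := by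
  refine small_of_mk_le_lift.{u, v}
    (κ := max Cardinal.aleph0 (Cardinal.mk (Shrink.{v} (Σ σ, K σ)))) ?_
  refine (SkolemTerm.mk_le σ).trans ?_
  rw [Cardinal.lift_max, Cardinal.lift_aleph0]
  refine max_le_max le_rfl (le_of_eq ?_)
  have := (equivShrink.{v} (Σ σ, K σ)).lift_cardinal_eq
  rw [Cardinal.lift_id'.{v, u}] at this
  rw [this]
  rw [Cardinal.lift_umax.{v, u}]

/-- A bound for the number of Skolem terms over at most `κ` constants. -/
theorem SkolemTerm.mk_le_lift [Encodable L.Sorts] [Encodable L.Funs] [Encodable L.Preds]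
    {K : L.Sorts → Type v} {κ : Cardinal.{v}} (hκ : Cardinal.aleph0 ≤ κ)
    (hK : ∀ σ, Cardinal.mk (K σ) ≤ κ) (σ : L.Sorts) :
    Cardinal.mk (SkolemTerm L K σ) ≤ Cardinal.lift.{u} κ := by
  refine (SkolemTerm.mk_le σ).trans (max_le (by simpa using hκ) ?_)
  have h : ∀ σ, Nonempty (K σ ↪ κ.out) := fun σ => by
    rw [← Cardinal.le_def, Cardinal.mk_out]
    exact hK σ
  let f : (Σ σ, K σ) → ℕ × κ.out := fun x => (Encodable.encode x.1, (h x.1).some x.2)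
  have hf : Function.Injective f := by
    rintro ⟨σ, a⟩ ⟨τ, b⟩ hab
    simp only [f, Prod.mk.injEq, Encodable.encode_inj] at hab
    obtain ⟨rfl, hab⟩ := hab
    rw [(h σ).some.injective hab]
  have h1 := Cardinal.lift_mk_le_lift_mk_of_injective hf
  have h2 : Cardinal.mk (ℕ × κ.out) ≤ κ := by
    rw [Cardinal.mk_prod, Cardinal.mk_out, Cardinal.mk_nat]
    simpa using Cardinal.mul_le_of_le hκ hκ le_rfl
  rw [Cardinal.lift_id'.{v, u}, Cardinal.lift_umax.{v, u}] at h1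
  exact h1.trans (Cardinal.lift_le.2 h2)

/-- If `T` has models of `φ` of all sufficiently large finite sizes in the sorts from `S`, then it
has models of `φ` of all sufficiently large, possibly infinite, sizes in these sorts. -/
theorem exists_model_card {S : Set L.Sorts} [Encodable L.Sorts] [Encodable L.Funs]
    [Encodable L.Preds] (T : Theory L) (φ : Formula L) (hS : S.Finite)
    (κ : L.Sorts → Cardinal.{v}) (hκ : ∀ σ, κ σ ≠ 0) (hκ1 : ∀ σ ∉ S, κ σ = 1)
    (m : L.Sorts → ℕ) (hm : ∀ σ ∈ S, (m σ : Cardinal) ≤ κ σ)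
    (hfin : ∀ n : L.Sorts → ℕ, (∀ σ ∈ S, m σ ≤ n σ) →
        ∃ B : Interpretation.{u, v} L, B.IsModel T ∧ B.Satisfies φ ∧
          ∀ σ ∈ S, Nonempty (B.carrier σ ≃ Fin (n σ))) :
    ∃ B : Interpretation.{u, v} L, B.IsModel T ∧ B.Satisfies φ ∧
      ∀ σ ∈ S, Cardinal.mk (B.carrier σ) = κ σ := by
  classical
  -- An infinite initial ordinal has no greatest element, so its finite subsets extend to infinite
  -- increasing sequences.
  let K : L.Sorts → Type v := fun σ => (κ σ).ord.ToType
  have hKκ : ∀ σ, Cardinal.mk (K σ) = κ σ := fun σ => Cardinal.mk_ord_toType _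
  have hKne : ∀ σ, Nonempty (K σ) := fun σ => Cardinal.mk_ne_zero_iff.1 (by rw [hKκ]; exact hκ σ)
  set P : Set L.Sorts := {σ | σ ∈ S ∧ Cardinal.aleph0 ≤ κ σ} with hPdef
  have hPS : P ⊆ S := fun σ h => h.1
  have hPfin : P.Finite := hS.subset hPS
  have hmax : ∀ σ ∈ P, NoMaxOrder (K σ) := fun σ hσ => Cardinal.noMaxOrder hσ.2
  have hSP : ∀ σ ∈ S, σ ∉ P → κ σ < Cardinal.aleph0 := fun σ h1 h2 =>
    not_le.1 fun h => h2 ⟨h1, h⟩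
  obtain ⟨r, rk, hinj, hlt, hsurj, hmono⟩ := hPfin.exists_ranking κ
  let Q : Structure.{u, v} L → Prop := fun B =>
    (∃ ν : Assignment B, (⟨B, ν⟩ : Interpretation.{u, v} L).IsModel T ∧ φ.Holds ν) ∧
      ∀ σ ∈ S, σ ∉ P → Nonempty (B.carrier σ ≃ K σ)
  have hQ : ∀ n : L.Sorts → ℕ, (∀ σ ∈ P, m σ ≤ n σ) →
      ∃ B : Structure.{u, v} L, Q B ∧ ∀ σ ∈ P, Nonempty (B.carrier σ ≃ Fin (n σ)) := by
    intro n hn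
    obtain ⟨B, hBT, hBφ, hB⟩ := hfin (fun σ => if σ ∈ P then n σ else (κ σ).toNat) (by
      intro σ hσ
      split_ifs with hσP
      · exact hn σ hσP
      · rw [← Nat.cast_le (α := Cardinal.{v}), Cardinal.cast_toNat_of_lt_aleph0 (hSP σ hσ hσP)]
        exact hm σ hσ)
    refine ⟨B.toStructure, ⟨⟨B.assignment, hBT, hBφ⟩, fun σ hσ hσP => ?_⟩, fun σ hσ => ?_⟩
    · obtain ⟨e⟩ := hB σ hσ
      rw [if_neg hσP] at e
      rw [← Cardinal.eq, hKκ, Cardinal.mk_congr (e.trans Equiv.ulift.{v}.symm), Cardinal.mk_uLift,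
        Cardinal.mk_fin, Cardinal.lift_natCast,
        Cardinal.cast_toNat_of_lt_aleph0 (hSP σ hσ hσP)]
    · simpa [hσ] using hB σ (hPS hσ)
  have key := fun i : Finset (Indiscernibility K P rk) × Finset (Σ σ, K σ) =>
    exists_indiscernible_constants hPfin hinj hlt hsurj Q m hQ i.1 i.2
  choose A hAQ c hcbij hcinj hcind using key
  -- Refining `atTop`, `U` makes each requirement and each inequality of constants hold almost
  -- everywhere.
  let U : Ultrafilter (Finset (Indiscernibility K P rk) × Finset (Σ σ, K σ)) :=
    Ultrafilter.of (Filter.atTop ×ˢ Filter.atTop)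
  have hUind : ∀ ρ : Indiscernibility K P rk, ∀ᶠ i in U,
      (ρ.term.map ρ.left).eval (A i) (c i) = (ρ.term.map ρ.right).eval (A i) (c i) := by
    intro ρ
    refine Ultrafilter.of_le _ ?_
    filter_upwards [(Filter.eventually_ge_atTop ({ρ} : Finset _)).prod_inl Filter.atTop] with i hi
    exact hcind i ρ (Finset.singleton_subset_iff.1 hi)
  have hUinj : ∀ σ ∈ S, ∀ a b : K σ, a ≠ b → ∀ᶠ i in U, c i σ a ≠ c i σ b := by
    intro σ hσ a b hab
    by_cases hσP : σ ∈ P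
    · refine Ultrafilter.of_le _ ?_
      filter_upwards [(Filter.eventually_ge_atTop
        ({⟨σ, a⟩, ⟨σ, b⟩} : Finset (Σ σ, K σ))).prod_inr Filter.atTop] with i hi h
      exact hab (hcinj i σ hσP a b (hi (by simp)) (hi (by simp)) h)
    · exact Filter.Eventually.of_forall fun i h =>
        hab ((hcbij i σ hσP ((hAQ i).2 σ hσ hσP)).1 h)
  let rel : (σ : L.Sorts) → Setoid (SkolemTerm L K σ) := fun σ =>
    { r := fun s t => ∀ᶠ i in U, s.eval (A i) (c i) = t.eval (A i) (c i)
      iseqv := ⟨fun s => Filter.Eventually.of_forall fun i => rfl, fun h => by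
          filter_upwards [h] with i hi using hi.symm, fun h h' => by
          filter_upwards [h, h'] with i hi hi' using hi.trans hi'⟩ }
  have hsmall : ∀ σ, Small.{v} (Quotient (rel σ)) := fun σ =>
    small_of_surjective (f := Quotient.mk (rel σ)) Quotient.mk_surjective
  let q : (σ : L.Sorts) → SkolemTerm L K σ → Shrink.{v} (Quotient (rel σ)) := fun σ t =>
    equivShrink _ (Quotient.mk (rel σ) t)
  have hq : ∀ σ, Function.Surjective (q σ) := fun σ =>
    (equivShrink _).surjective.comp Quotient.mk_surjective
  have hker : ∀ σ s t, q σ s = q σ t ↔ ∀ᶠ i in U, s.eval (A i) (c i) = t.eval (A i) (c i) :=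
    fun σ s t => (equivShrink _).injective.eq_iff.trans Quotient.eq
  let g₀ : (σ : L.Sorts) → ℕ → SkolemTerm L K σ := fun σ _ => .const σ (hKne σ).some
  have hlos := fun χ : Formula L => limitStructure_holds U A c hq hker χ g₀
  -- The assignments in the `A i` need not be values of Skolem terms, so the existential closure of
  -- `φ` is transferred instead.
  obtain ⟨ν, -, hν⟩ := Formula.holds_exs.1 ((hlos (Formula.exs φ.vars.toList φ)).2
    (Filter.Eventually.of_forall fun i => by
      obtain ⟨ν, -, hν⟩ := (hAQ i).1
      exact (Formula.holds_of_vars_eq_empty φ.vars_exs_toList _ _).1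
        (Formula.holds_exs.2 ⟨ν, fun _ _ => rfl, hν⟩)))
  refine ⟨⟨limitStructure U A c hq, ν⟩, fun θ hθ => ?_, hν, fun σ hσ => le_antisymm ?_ ?_⟩
  · refine (Formula.holds_of_vars_eq_empty θ.2 _ _).1 ((hlos θ.1).2
      (Filter.Eventually.of_forall fun i => ?_))
    obtain ⟨ν, hν, -⟩ := (hAQ i).1
    exact (Formula.holds_of_vars_eq_empty θ.2 _ _).1 (hν θ hθ)
  · change Cardinal.mk (Shrink.{v} (Quotient (rel σ))) ≤ κ σ
    by_cases hσP : σ ∈ P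
    · choose ω hω using fun τ => show ∃ ω : ℕ → K τ, τ ∈ P → StrictMono ω by
        by_cases hτ : τ ∈ P
        · have := hmax τ hτ
          obtain ⟨f, hf, -⟩ := (∅ : Finset (K τ)).exists_strictMono_nat
          exact ⟨f, fun _ => hf⟩
        · exact ⟨fun _ => (hKne τ).some, fun h => absurd h hτ⟩
      -- Constants of higher rank are confined to the range of `ω τ`; each other sort has at most `κ
      -- σ` constants anyway.
      let K' : L.Sorts → Type v := fun τ =>
        {a : K τ // (τ ∈ P ∧ rk σ < rk τ) → a ∈ Set.range (ω τ)}
      have hK' : ∀ τ, Cardinal.mk (K' τ) ≤ κ σ := by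
        intro τ
        by_cases hτ : τ ∈ P ∧ rk σ < rk τ
        · have : Function.Injective (fun a : K' τ => (⟨a.1, a.2 hτ⟩ : Set.range (ω τ))) := by
            intro a b hab
            exact Subtype.ext (Subtype.mk.inj hab)
          have hr := (Set.countable_range (ω τ)).to_subtype
          have : Countable (K' τ) := this.countable
          exact Cardinal.mk_le_aleph0.trans hσP.2
        · refine (Cardinal.mk_subtype_le _).trans ?_
          rw [hKκ]
          by_cases hτP : τ ∈ P
          · exact hmono τ hτP σ hσP (not_lt.1 fun h => hτ ⟨hτP, h⟩)
          by_cases hτS : τ ∈ S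
          · exact (hSP τ hτS hτP).le.trans hσP.2
          · rw [hκ1 τ hτS]
            exact Cardinal.one_le_aleph0.trans hσP.2
      have hsurj : Function.Surjective fun t : SkolemTerm L K' σ =>
          q σ (t.map fun _ a => a.1) := by
        intro x
        obtain ⟨t, rfl⟩ := hq σ x
        obtain ⟨D, hD⟩ := t.exists_finset_constsIn
        let Dτ : (τ : L.Sorts) → Finset (K τ) := fun τ =>
          D.preimage (Sigma.mk τ) sigma_mk_injective.injOn
        choose f hf hfmono using fun τ => show ∃ f : ℕ → K τ, (∀ a ∈ Dτ τ, ∃ k, f k = a) ∧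
            (τ ∈ P → StrictMono f) by
          by_cases hτ : τ ∈ P
          · have := hmax τ hτ
            obtain ⟨f, hf, hfD⟩ := (Dτ τ).exists_strictMono_nat
            exact ⟨f, hfD, fun _ => hf⟩
          · obtain ⟨f, hf⟩ := (insert (hKne τ).some (Dτ τ)).countable_toSet.exists_eq_range
              ⟨(hKne τ).some, by simp⟩
            exact ⟨f, fun a ha => by
              have : a ∈ Set.range f := hf ▸ Finset.mem_coe.2 (Finset.mem_insert_of_mem ha)
              exact this, fun h => absurd h hτ⟩
        obtain ⟨t₀, rfl⟩ := hD.exists_map_eq (f := f) fun τ a ha =>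
          hf τ a (Finset.mem_preimage.2 (Finset.mem_coe.1 ha))
        -- Only the constants of higher rank move, from `f` to `ω`; both sequences increase, so
        -- indiscernibility preserves the class of the term.
        let g : (τ : L.Sorts) → ℕ → K' τ := fun τ k =>
          if h : τ ∈ P ∧ rk σ < rk τ then ⟨ω τ k, fun _ => ⟨k, rfl⟩⟩
          else ⟨f τ k, fun h' => absurd h' h⟩
        refine ⟨t₀.map g, (hker _ _ _).2 ?_⟩
        rw [SkolemTerm.map_map]
        have hg : ∀ τ, ¬(τ ∈ P ∧ rk σ < rk τ) → (fun k => (g τ k).1) = f τ := fun τ h => by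
          funext k
          simp only [g, dif_neg h]
        have hg' : ∀ τ, (τ ∈ P ∧ rk σ < rk τ) → (fun k => (g τ k).1) = ω τ := fun τ h => by
          funext k
          simp only [g, dif_pos h]
        exact hUind
          { sort := σ
            sort_mem := hσP
            term := t₀
            left := fun τ k => (g τ k).1
            right := f
            agree := fun τ h => hg τ fun h' => (h h'.1).not_gt h'.2
            strictMono := fun τ h h' => ⟨by rw [hg' τ ⟨h, h'⟩]; exact hω τ h, hfmono τ h⟩ }
      have h1 := Cardinal.lift_mk_le_lift_mk_of_surjective hsurj
      rw [Cardinal.lift_id'.{v, u}, Cardinal.lift_umax.{v, u}] at h1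
      exact Cardinal.lift_le.1 (h1.trans (SkolemTerm.mk_le_lift hσP.2 hK' σ))
    · have hfinK : Finite (K σ) := Cardinal.lt_aleph0_iff_finite.1 (by
        rw [hKκ]; exact hSP σ hσ hσP)
      rw [← hKκ]
      refine Cardinal.mk_le_of_surjective (f := fun a => q σ (.const σ a)) fun x => ?_
      obtain ⟨t, rfl⟩ := hq σ x
      -- There are finitely many constants `a`, so the ultrafilter selects a single one.
      have : ∀ᶠ i in U, ∃ a, (SkolemTerm.const σ a).eval (A i) (c i) = t.eval (A i) (c i) :=
        Filter.Eventually.of_forall fun i => (hcbij i σ hσP ((hAQ i).2 σ hσ hσP)).2 _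
      obtain ⟨a, ha⟩ := Ultrafilter.eventually_exists_iff.1 this
      exact ⟨a, (hker _ _ _).2 ha⟩
  · change κ σ ≤ Cardinal.mk (Shrink.{v} (Quotient (rel σ)))
    rw [← hKκ]
    refine Cardinal.mk_le_of_injective (f := fun a => q σ (.const σ a)) fun a b hab => ?_
    by_contra hne
    obtain ⟨i, h1, h2⟩ := (((hker _ _ _).1 hab).and (hUinj σ hσ a b hne)).exists
    exact h2 h1

end ManySorted

/-- Over a countable signature (with a fixed numbering of its symbols), every theory that is
stably infinite and strongly finitely witnessable with respect to `S` is smooth with respect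
to `S`. -/
theorem mainTheorem1 (L : ManySorted.Signature.{u})
    [Encodable L.Sorts] [Encodable L.Funs] [Encodable L.Preds]
    (T : ManySorted.Theory L) (S : Set L.Sorts)
    (hinf : ManySorted.Theory.StablyInfinite.{u, v} T S)
    (hwit : ManySorted.Theory.StronglyFinitelyWitnessable.{u, v} T S) :
    ManySorted.Theory.Smooth.{u, v} T S := by
  classical
  intro φ A hA hφ κ hκ
  obtain ⟨hS, m, hm, hfin⟩ := ManySorted.Theory.exists_model_card_eq hinf hwit φ A hA hφ
  have hpos : ∀ σ : S, κ σ ≠ 0 := fun σ h => by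
    have := A.carrier_nonempty σ
    exact Cardinal.mk_ne_zero (A.carrier σ) (le_antisymm (h ▸ hκ σ) (zero_le))
  -- One constant in each sort outside `S` adds at most countably many, too few to spoil the bounds
  -- for the infinite sorts.
  obtain ⟨B, hBT, hBφ, hB⟩ := ManySorted.exists_model_card (S := S) T φ.1 hS
    (fun σ => if h : σ ∈ S then κ ⟨σ, h⟩ else 1)
    (fun σ => by
      split_ifs with h
      · exact hpos ⟨σ, h⟩
      · exact one_ne_zero)
    (fun σ h => dif_neg h) m
    (fun σ h => by
      rw [dif_pos h]
      exact (hm σ h).trans (hκ ⟨σ, h⟩)) hfin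
  exact ⟨B, hBT, hBφ, fun σ => by rw [hB σ σ.2, dif_pos σ.2]⟩
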